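/- **Conventions.** Slopes on the torus are the elements of $\mathbb{Q}\cup\{1/0\}$, with geometric intersection number $i(a/b,c/d)=|ad-bc|$. The Farey triangulation of $\mathbb{H}^2$ has an edge between any two slopes with intersection number $1$. Let $p,q,r$ be slopes spanning a Farey triangle $T_0$, let $m$ be a slope, and let $(T_0,T_1,\dots,T_N)$ be the sequence of Farey triangles crossed by the geodesic from the centre of $T_0$ to the ideal point $m$, so that $m$ is a vertex of $T_N$ and of no earlier triangle. Assume $N\ge 2$. The *layered solid torus* $T$ with boundary slopes $p,q,r$ and meridian $m$ is the ideal triangulation with $N-1$ tetrahedra obtained as follows. Start with the once-punctured torus triangulated by the edges of slopes $p,q,r$. For $k=1,\dots,N-1$ layer on a tetrahedron effecting the diagonal exchange from $T_{k-1}$ to $T_k$. Finally fold the two triangles of the innermost torus, which is triangulated by $T_{N-1}$, onto each other across the edge whose slope does not belong to $T_N$; this makes $m$ homotopically trivial. An *angle structure* on $T$ assigns a dihedral angle to every edge of every tetrahedron so that opposite edges of a tetrahedron have equal angles, all angles lie in $(0,\pi)$, the three angles at each ideal vertex of each tetrahedron sum to $\pi$, and the angles around each interior edge of $T$ sum to $2\pi$.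 The interior dihedral angle at a boundary edge is the sum of the angles of the tetrahedra at that edge, and its exterior angle is $\pi$ minus the interior one. **Proposition.** Let $p,q,r,m$ be as above with $N\ge 2$ (that is, $m$ is separated from the triangle $pqr$ by at least one Farey triangle), and label $p,q,r$ so that $r$ is the first of these slopes to disappear from the sequence and $p$ the second: $T_1=\{p,q,r'\}$ with $r'\neq r$, and $p\notin T_2$. Let $\theta_p,\theta_q,\theta_r$ be real numbers with $$\theta_p+\theta_q+\theta_r=\pi,\qquad -\pi<\theta_p,\theta_q<\pi,\qquad 0<\theta_r<\pi .$$ Then the layered solid torus $T$ with boundary slopes $p,q,r$ and meridian $m$ admits an angle structure whose interior dihedral angles at the boundary edges of slopes $p,q,r$ are $\pi-\theta_p$, $\pi-\theta_q$, $\pi-\theta_r$, respectively, if and only if $$ i(m,p)\,\theta_p+i(m,q)\,\theta_q+i(m,r)\,\theta_r>2\pi .$$ -/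

import Mathlib

/-! ### Slopes and the Farey triangulation -/

/-- Slopes on the (once-punctured) torus: the points of `ℚ ∪ {1/0}`. -/
abbrev Slope : Type := OnePoint ℚ

instance instDecidableEqSlope : DecidableEq Slope := inferInstanceAs (DecidableEq (Option ℚ))

namespace Slope

/-- The primitive lattice vector `(a, b)` of the slope `a/b` in lowest terms, with `b > 0`, or
`(1, 0)` for the slope `1/0`. -/
def vec (s : Slope) : ℤ × ℤ := s.elim (1, 0) (fun x => (x.num, (x.den : ℤ)))

/-- The slope `a/b` of a non-zero lattice vector `(a, b)`. -/
def ofVec (v : ℤ × ℤ) : Slope :=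
  if v.2 = 0 then OnePoint.infty else OnePoint.some ((v.1 : ℚ) / (v.2 : ℚ))

/-- Geometric intersection number `i(a/b, c/d) = |ad - bc|`. -/
def inter (s t : Slope) : ℕ := (s.vec.1 * t.vec.2 - s.vec.2 * t.vec.1).natAbs

end Slope

/-- Three slopes spanning a triangle of the Farey triangulation. -/
def IsFareyTriangle (T : Finset Slope) : Prop :=
  T.card = 3 ∧ ∀ s ∈ T, ∀ t ∈ T, s ≠ t → Slope.inter s t = 1

/-- The sequence of Farey triangles `T₀, T₁, …, T_N` met by the geodesic from the centre of `T₀` to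
the ideal point `m`: consecutive triangles share an edge, the path never turns back, and `T_N` is
the first (and only) triangle of the sequence with the vertex `m`.  As the dual graph of the Farey
triangulation is a tree, these conditions determine the sequence.  Only the values `tri i` with
`i ≤ N` matter. -/
structure FareyPath (T₀ : Finset Slope) (m : Slope) where
  length : ℕ
  tri : ℕ → Finset Slope
  tri_zero : tri 0 = T₀
  isFareyTriangle : ∀ i ≤ length, IsFareyTriangle (tri i)
  card_inter : ∀ i < length, (tri i ∩ tri (i + 1)).card = 2
  ne_of_two_steps : ∀ i, i + 2 ≤ length → tri (i + 2) ≠ tri i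
  mem_iff : ∀ i ≤ length, (m ∈ tri i ↔ i = length)

namespace Slope

theorem isCoprime_vec (s : Slope) : IsCoprime s.vec.1 s.vec.2 := by
  induction s using OnePoint.rec with
  | infty => exact isCoprime_one_left
  | coe x => exact Int.isCoprime_iff_gcd_eq_one.2 x.reduced

theorem inter_self (s : Slope) : inter s s = 0 := by
  simp [inter, mul_comm]

theorem inter_comm (s t : Slope) : inter s t = inter t s := by
  unfold inter
  rw [← Int.natAbs_neg]
  congr 1
  ring

theorem eq_of_inter_eq_zero {s t : Slope} (h : inter s t = 0) : s = t := by
  unfold inter at h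
  rw [Int.natAbs_eq_zero, sub_eq_zero] at h
  induction s using OnePoint.rec with
  | infty =>
    induction t using OnePoint.rec with
    | infty => rfl
    | coe y => exact absurd h (by simp [vec])
  | coe x =>
    induction t using OnePoint.rec with
    | infty => exact absurd h (by
        simp only [vec, OnePoint.elim_some, OnePoint.elim_infty]
        have := x.den_nz
        omega)
    | coe y =>
      simp only [vec, OnePoint.elim_some] at h
      congr 1
      rw [Rat.eq_iff_mul_eq_mul]
      linarith

/-- A primitive vector is, up to sign, the vector of its slope. -/
theorem vec_ofVec {v : ℤ × ℤ} (h : IsCoprime v.1 v.2) : (ofVec v).vec = v ∨ (ofVec v).vec = -v := by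
  obtain ⟨a, b⟩ := v
  simp only at h
  by_cases hb : b = 0
  · subst hb
    rcases Int.isUnit_iff.1 (isCoprime_zero_right.1 h) with rfl | rfl <;> simp [ofVec, vec]
  · have h2 : ofVec (a, b) = OnePoint.some ((a : ℚ) / (b : ℚ)) := by simp [ofVec, hb]
    rw [h2]
    have hc : Nat.Coprime a.natAbs b.natAbs := Int.isCoprime_iff_gcd_eq_one.1 h
    rcases lt_or_gt_of_ne hb with hlt | hgt
    · right
      have h3 : (a : ℚ) / (b : ℚ) = ((-a : ℤ) : ℚ) / ((-b : ℤ) : ℚ) := by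
        push_cast; rw [neg_div_neg_eq]
      have hc' : Nat.Coprime (-a).natAbs (-b).natAbs := by simpa using hc
      rw [h3]
      simp only [vec, OnePoint.elim_some]
      rw [Rat.num_div_eq_of_coprime (by omega) hc', Rat.den_div_eq_of_coprime (by omega) hc']
      rfl
    · left
      simp only [vec, OnePoint.elim_some]
      rw [Rat.num_div_eq_of_coprime hgt hc, Rat.den_div_eq_of_coprime hgt hc]

end Slope

theorem IsFareyTriangle.descent_aux {a b c m : Slope} (hab : Slope.inter a b = 1)
    (hac : Slope.inter a c = 1) (hbc : Slope.inter b c = 1)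
    (ha : Slope.inter a m ≠ 0) (hb : Slope.inter b m ≠ 0)
    (h : Slope.inter c m = Slope.inter a m + Slope.inter b m) :
    ∃ c', Slope.inter a c' = 1 ∧ Slope.inter b c' = 1 ∧ Slope.inter c' m < Slope.inter c m := by
  have key : ∃ e f : ℤ, (e = 1 ∨ e = -1) ∧ (f = 1 ∨ f = -1) ∧
      c.vec = (e * a.vec.1 + f * b.vec.1, e * a.vec.2 + f * b.vec.2) := by
    unfold Slope.inter at hab hac hbc
    set D := a.vec.1 * b.vec.2 - a.vec.2 * b.vec.1 with hD
    have hD1 : D * D = 1 := by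
      rcases Int.natAbs_eq_iff.1 hab with h | h <;> rw [h] <;> norm_num
    have hDu : D = 1 ∨ D = -1 := by simpa using Int.natAbs_eq_iff.1 hab
    refine ⟨-D * (b.vec.1 * c.vec.2 - b.vec.2 * c.vec.1),
      D * (a.vec.1 * c.vec.2 - a.vec.2 * c.vec.1), ?_, ?_, ?_⟩
    · rcases Int.natAbs_eq_iff.1 hbc with h | h <;> rw [h] <;> rcases hDu with h | h <;> simp [h]
    · rcases Int.natAbs_eq_iff.1 hac with h | h <;> rw [h] <;> rcases hDu with h | h <;> simp [h]
    · ext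
      · linear_combination (-c.vec.1) * hD1 + D * c.vec.1 * hD
      · linear_combination (-c.vec.2) * hD1 + D * c.vec.2 * hD
  obtain ⟨e, f, he, hf, hv⟩ := key
  have hdet : a.vec.1 * b.vec.2 - a.vec.2 * b.vec.1 = 1 ∨
      a.vec.1 * b.vec.2 - a.vec.2 * b.vec.1 = -1 := by
    simpa using Int.natAbs_eq_iff.1 hab
  set v : ℤ × ℤ := (e * a.vec.1 - f * b.vec.1, e * a.vec.2 - f * b.vec.2) with hvdef
  have hav : a.vec.1 * v.2 - a.vec.2 * v.1 =
      -f * (a.vec.1 * b.vec.2 - a.vec.2 * b.vec.1) := by simp only [hvdef]; ring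
  have hbv : b.vec.1 * v.2 - b.vec.2 * v.1 =
      -e * (a.vec.1 * b.vec.2 - a.vec.2 * b.vec.1) := by simp only [hvdef]; ring
  have hcop : IsCoprime v.1 v.2 := by
    rcases hf with rfl | rfl <;> rcases hdet with h1 | h1 <;> rw [h1] at hav
    · exact ⟨a.vec.2, -a.vec.1, by linarith⟩
    · exact ⟨-a.vec.2, a.vec.1, by linarith⟩
    · exact ⟨-a.vec.2, a.vec.1, by linarith⟩
    · exact ⟨a.vec.2, -a.vec.1, by linarith⟩
  refine ⟨Slope.ofVec v, ?_, ?_, ?_⟩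
  · have : (a.vec.1 * v.2 - a.vec.2 * v.1).natAbs = 1 := by
      rw [hav]; rcases hf with rfl | rfl <;> rcases hdet with h1 | h1 <;> rw [h1] <;> rfl
    rcases Slope.vec_ofVec hcop with h1 | h1 <;> simp only [Slope.inter, h1, Prod.fst_neg, Prod.snd_neg]
    · exact this
    · rw [← this, ← Int.natAbs_neg]; congr 1; ring
  · have : (b.vec.1 * v.2 - b.vec.2 * v.1).natAbs = 1 := by
      rw [hbv]; rcases he with rfl | rfl <;> rcases hdet with h1 | h1 <;> rw [h1] <;> rfl
    rcases Slope.vec_ofVec hcop with h1 | h1 <;> simp only [Slope.inter, h1, Prod.fst_neg, Prod.snd_neg]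
    · exact this
    · rw [← this, ← Int.natAbs_neg]; congr 1; ring
  · have h0 : Slope.inter (Slope.ofVec v) m = (v.1 * m.vec.2 - v.2 * m.vec.1).natAbs := by
      rcases Slope.vec_ofVec hcop with h1 | h1 <;>
        simp only [Slope.inter, h1, Prod.fst_neg, Prod.snd_neg]
      rw [← Int.natAbs_neg]; congr 1; ring
    rw [h0]
    have hvm : v.1 * m.vec.2 - v.2 * m.vec.1 = e * (a.vec.1 * m.vec.2 - a.vec.2 * m.vec.1) -
        f * (b.vec.1 * m.vec.2 - b.vec.2 * m.vec.1) := by simp only [hvdef]; ring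
    have hcm : c.vec.1 * m.vec.2 - c.vec.2 * m.vec.1 =
        e * (a.vec.1 * m.vec.2 - a.vec.2 * m.vec.1) +
        f * (b.vec.1 * m.vec.2 - b.vec.2 * m.vec.1) := by rw [hv]; ring
    unfold Slope.inter at ha hb h ⊢
    rw [hvm]
    rw [hcm] at h ⊢
    rcases he with rfl | rfl <;> rcases hf with rfl | rfl <;> omega

theorem isFareyTriangle_of {a b c : Slope} (hab : Slope.inter a b = 1)
    (hac : Slope.inter a c = 1) (hbc : Slope.inter b c = 1) : IsFareyTriangle {a, b, c} := by
  have ne : ∀ {s t : Slope}, Slope.inter s t = 1 → s ≠ t := by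
    rintro s t h rfl
    rw [Slope.inter_self] at h
    exact absurd h (by norm_num)
  refine ⟨Finset.card_eq_three.2 ⟨a, b, c, ne hab, ne hac, ne hbc, rfl⟩, ?_⟩
  intro s hs t ht hst
  simp only [Finset.mem_insert, Finset.mem_singleton] at hs ht
  have hba := Slope.inter_comm a b ▸ hab
  have hca := Slope.inter_comm a c ▸ hac
  have hcb := Slope.inter_comm b c ▸ hbc
  rcases hs with rfl | rfl | rfl <;> rcases ht with rfl | rfl | rfl <;>
    first | assumption | exact absurd rfl hst

/-- One step towards `m`. -/
theorem IsFareyTriangle.descent {T : Finset Slope} (hT : IsFareyTriangle T) {m : Slope}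
    (hm : m ∉ T) : ∃ T', IsFareyTriangle T' ∧ (T ∩ T').card = 2 ∧
      ∑ s ∈ T', Slope.inter s m < ∑ s ∈ T, Slope.inter s m := by
  have main : ∀ a b c : Slope, T = {a, b, c} → a ≠ b → a ≠ c → b ≠ c →
      Slope.inter c m = Slope.inter a m + Slope.inter b m →
      ∃ T', IsFareyTriangle T' ∧ (T ∩ T').card = 2 ∧
      ∑ s ∈ T', Slope.inter s m < ∑ s ∈ T, Slope.inter s m := by
    rintro a b c rfl nab nac nbc h
    have ne0 : ∀ s ∈ ({a, b, c} : Finset Slope), Slope.inter s m ≠ 0 := by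
      intro s hs h0
      exact hm (Slope.eq_of_inter_eq_zero h0 ▸ hs)
    have hab := hT.2 a (by simp) b (by simp) nab
    obtain ⟨c', h1, h2, h3⟩ := IsFareyTriangle.descent_aux hab
      (hT.2 a (by simp) c (by simp) nac) (hT.2 b (by simp) c (by simp) nbc)
      (ne0 a (by simp)) (ne0 b (by simp)) h
    have nac' : a ≠ c' := by
      rintro rfl; rw [Slope.inter_self] at h1; exact absurd h1 (by norm_num)
    have nbc' : b ≠ c' := by
      rintro rfl; rw [Slope.inter_self] at h2; exact absurd h2 (by norm_num)
    have ncc' : c ≠ c' := by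
      intro hcc; rw [hcc] at h3; exact lt_irrefl _ h3
    refine ⟨{a, b, c'}, isFareyTriangle_of hab h1 h2, ?_, ?_⟩
    · have : ({a, b, c} ∩ {a, b, c'} : Finset Slope) = {a, b} := by
        ext x
        simp only [Finset.mem_inter, Finset.mem_insert, Finset.mem_singleton]
        constructor
        · rintro ⟨hx | hx | hx, hy⟩
          · exact Or.inl hx
          · exact Or.inr hx
          · rcases hy with hy | hy | hy
            · exact Or.inl hy
            · exact Or.inr hy
            · exact absurd (hx.symm.trans hy) ncc'
        · tauto
      rw [this, Finset.card_pair nab]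
    · rw [Finset.sum_insert (by simp [nab, nac']), Finset.sum_insert (by simp [nbc']),
        Finset.sum_singleton, Finset.sum_insert (by simp [nab, nac]),
        Finset.sum_insert (by simp [nbc]), Finset.sum_singleton]
      omega
  obtain ⟨a, b, c, nab, nac, nbc, hTe⟩ := Finset.card_eq_three.1 hT.1
  have hab := hT.2 a (by simp [hTe]) b (by simp [hTe]) nab
  have hac := hT.2 a (by simp [hTe]) c (by simp [hTe]) nac
  have hbc := hT.2 b (by simp [hTe]) c (by simp [hTe]) nbc
  have hcases : Slope.inter c m = Slope.inter a m + Slope.inter b m ∨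
      Slope.inter b m = Slope.inter a m + Slope.inter c m ∨
      Slope.inter a m = Slope.inter b m + Slope.inter c m := by
    unfold Slope.inter at hab hac hbc ⊢
    have pl : (a.vec.1 * b.vec.2 - a.vec.2 * b.vec.1) * (c.vec.1 * m.vec.2 - c.vec.2 * m.vec.1) -
        (a.vec.1 * c.vec.2 - a.vec.2 * c.vec.1) * (b.vec.1 * m.vec.2 - b.vec.2 * m.vec.1) +
        (b.vec.1 * c.vec.2 - b.vec.2 * c.vec.1) * (a.vec.1 * m.vec.2 - a.vec.2 * m.vec.1) = 0 := by
      ring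
    rcases Int.natAbs_eq_iff.1 hab with h1 | h1 <;> rcases Int.natAbs_eq_iff.1 hac with h2 | h2 <;>
      rcases Int.natAbs_eq_iff.1 hbc with h3 | h3 <;> rw [h1, h2, h3] at pl <;> push_cast at pl <;>
      omega
  rcases hcases with h | h | h
  · exact main a b c hTe nab nac nbc h
  · exact main a c b (by rw [hTe]; congr 1; exact Finset.pair_comm b c) nac nab nbc.symm h
  · exact main b c a (by rw [hTe]; ext; simp; tauto) nbc nab.symm nac.symm h

/-- The Farey path from a triangle to a slope always exists. -/
theorem FareyPath.nonempty {T₀ : Finset Slope} (hT : IsFareyTriangle T₀) (m : Slope) :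
    Nonempty (FareyPath T₀ m) := by
  suffices H : ∀ n : ℕ, ∀ T : Finset Slope, IsFareyTriangle T → ∑ s ∈ T, Slope.inter s m = n →
      ∃ γ : FareyPath T m, ∀ i < γ.length,
        ∑ s ∈ γ.tri (i + 1), Slope.inter s m < ∑ s ∈ γ.tri i, Slope.inter s m from
    let ⟨γ, _⟩ := H _ T₀ hT rfl
    ⟨γ⟩
  intro n
  induction n using Nat.strong_induction_on with
  | _ n ih =>
    intro T hT hn
    by_cases hm : m ∈ T
    · refine ⟨⟨0, fun _ => T, rfl, fun _ _ => hT, by simp, by simp, ?_⟩, by simp⟩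
      intro i hi
      simp [hm, Nat.le_zero.1 hi]
    · obtain ⟨T', hT', hcard, hlt⟩ := hT.descent hm
      obtain ⟨γ, hγ⟩ := ih _ (hn ▸ hlt) T' hT' rfl
      have hdec : ∀ i < γ.length + 1,
          ∑ s ∈ (fun i => Nat.casesOn i T γ.tri : ℕ → Finset Slope) (i + 1), Slope.inter s m <
          ∑ s ∈ (fun i => Nat.casesOn i T γ.tri : ℕ → Finset Slope) i, Slope.inter s m := by
        rintro (_ | i) hi
        · simpa [γ.tri_zero] using hlt
        · exact hγ i (by omega)
      refine ⟨⟨γ.length + 1, fun i => Nat.casesOn i T γ.tri, rfl, ?_, ?_, ?_, ?_⟩, hdec⟩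
      · rintro (_ | i) hi
        · exact hT
        · exact γ.isFareyTriangle i (by omega)
      · rintro (_ | i) hi
        · simpa [γ.tri_zero] using hcard
        · exact γ.card_inter i (by omega)
      · intro i hi h
        have h1 := hdec i (by omega)
        have h2 := hdec (i + 1) (by omega)
        have h3 : ∑ s ∈ (fun i => Nat.casesOn i T γ.tri : ℕ → Finset Slope) (i + 1 + 1),
            Slope.inter s m =
            ∑ s ∈ (fun i => Nat.casesOn i T γ.tri : ℕ → Finset Slope) i, Slope.inter s m :=
          congrArg (fun S : Finset Slope => ∑ s ∈ S, Slope.inter s m) h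
        rw [h3] at h2
        exact lt_asymm h1 h2
      · rintro (_ | i) hi
        · simp [hm]
        · have := γ.mem_iff i (by omega)
          simpa using this

/-! ### Ideal triangulations and angle structures -/

/-- An edge of a model tetrahedron with vertex set `Fin 4`: a pair of vertices. -/
abbrev TetEdge : Type := {e : Finset (Fin 4) // e.card = 2}

namespace TetEdge

/-- The opposite edge. -/
def opp (e : TetEdge) : TetEdge :=
  ⟨e.1ᶜ, by rw [Finset.card_compl, e.2, Fintype.card_fin]⟩

/-- The image of an edge under a relabelling of the vertices. -/
def map (σ : Equiv.Perm (Fin 4)) (e : TetEdge) : TetEdge :=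
  ⟨e.1.map σ.toEmbedding, by rw [Finset.card_map, e.2]⟩

end TetEdge

/-- An ideal triangulation with tetrahedra indexed by `ι`.  Face `f` of a tetrahedron is the face
opposite to its vertex `f`.  `glue t f = none` means that face `f` of `t` lies in the boundary;
`glue t f = some (t', σ)` means that face `f` of `t` is glued to face `σ f` of `t'`, each vertex
`v ≠ f` of the first face going to the vertex `σ v` of the second. -/
structure IdealTriangulation (ι : Type) where
  glue : ι → Fin 4 → Option (ι × Equiv.Perm (Fin 4))
  glue_symm : ∀ t f t' σ, glue t f = some (t', σ) → glue t' (σ f) = some (t, σ⁻¹)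
  glue_ne : ∀ t f t' σ, glue t f = some (t', σ) → (t', σ f) ≠ (t, f)

namespace IdealTriangulation

variable {ι : Type} (τ : IdealTriangulation ι)

/-- Two edges of tetrahedra are identified by a face gluing. -/
def EdgeStep (x y : ι × TetEdge) : Prop :=
  ∃ f σ, f ∉ x.2.1 ∧ τ.glue x.1 f = some (y.1, σ) ∧ y.2 = x.2.map σ

/-- The edges of the triangulation: classes of edges of tetrahedra under the equivalence relation
generated by the face gluings. -/
def Edge : Type := Quot τ.EdgeStep

/-- The edge of the triangulation that is the image of the edge `e` of the tetrahedron `t`. -/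
def edge (t : ι) (e : TetEdge) : τ.Edge := Quot.mk _ (t, e)

/-- An edge lies in the boundary if it is an edge of some boundary face. -/
def IsBoundaryEdge (E : τ.Edge) : Prop :=
  ∃ t e f, τ.edge t e = E ∧ f ∉ e.1 ∧ τ.glue t f = none

open Classical in
/-- The sum of the dihedral angles `α` of all tetrahedra around an edge of the triangulation. -/
noncomputable def angleSum [Fintype ι] (α : ι → TetEdge → ℝ) (E : τ.Edge) : ℝ :=
  ∑ t : ι, ∑ e : TetEdge, if τ.edge t e = E then α t e else 0

/-- Angle structures: `α t e` is the dihedral angle of the tetrahedron `t` at its edge `e`. -/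
structure IsAngleStructure [Fintype ι] (α : ι → TetEdge → ℝ) : Prop where
  opp : ∀ t e, α t e.opp = α t e
  pos : ∀ t e, 0 < α t e
  lt_pi : ∀ t e, α t e < Real.pi
  vertex : ∀ t v, ∑ e : TetEdge with v ∈ e.1, α t e = Real.pi
  interior : ∀ E : τ.Edge, ¬ τ.IsBoundaryEdge E → τ.angleSum α E = 2 * Real.pi

end IdealTriangulation

/-! ### Layered solid tori

The tetrahedron `Δ` effecting a diagonal exchange is a thickened parallelogram in the torus
`ℝ² / ℤ²`.  If `u, w` is a basis of `ℤ²`, its vertices `0, 1, 2, 3` lie over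
`0, u, u + w, w`.  The outer faces (those opposite to the vertices `0` and `2`) contain the diagonal
of direction `u - w` that is covered, and the inner faces (those opposite to `1` and `3`) contain the
new diagonal of direction `u + w`.  Next, either the side `u` or the side `w` is exchanged, and the
basis of the next tetrahedron is `(u + w, w)` or `(u, u + w)` respectively. -/

namespace LayeredSolidTorus

/-- The gluing of face `f` of a tetrahedron across the torus between two consecutive tetrahedra:
inner faces `1, 3` of one and outer faces `0, 2` of the next.  It is induced by a translation of the
torus; `d` tells whether the side `u` of the outer tetrahedron is the one exchanged by the inner one
(otherwise it is the side `w`).  For example, if `d` holds then the vertices `0, u, u + w` of face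
`3` are translated by `w` to the vertices `w`, `u + w`, `(u + w) + w` of face `0` of the next
tetrahedron. -/
def layer (d : Bool) (f : Fin 4) : Equiv.Perm (Fin 4) :=
  if d then (if f = 0 ∨ f = 3 then Equiv.swap 0 3 else Equiv.swap 1 2)
  else (if f = 0 ∨ f = 1 then Equiv.swap 0 1 else Equiv.swap 2 3)

/-- Folding of the innermost torus: the inner face `3` is folded onto the inner face `1` across the
side `u` (if `d`) or `w` (otherwise).  This side is translated to its parallel copy in the other
face, and the third vertex goes to the third vertex: `0 ↦ 3, 1 ↦ 2, 2 ↦ 0` for `u`, and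
`1 ↦ 0, 2 ↦ 3, 0 ↦ 2` for `w`. -/
def fold (d : Bool) : Equiv.Perm (Fin 4) :=
  if d then ⟨![3, 2, 0, 1], ![2, 3, 1, 0], by decide, by decide⟩
  else ⟨![2, 0, 3, 1], ![1, 3, 0, 2], by decide, by decide⟩

/-- The face gluings of `n` tetrahedra layered on each other, the last one being folded up; `d k`
tells which side of the `k`-th tetrahedron is the next one to be exchanged or, for the last
tetrahedron, to be folded across (`true` for `u`, `false` for `w`). -/
def glue (n : ℕ) (d : ℕ → Bool) (k : Fin n) (f : Fin 4) :
    Option (Fin n × Equiv.Perm (Fin 4)) :=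
  if f = 0 ∨ f = 2 then
    if 0 < k.1 then some (⟨k.1 - 1, by omega⟩, layer (d (k.1 - 1)) f) else none
  else
    if h : k.1 + 1 < n then some (⟨k.1 + 1, h⟩, layer (d k.1) f)
    else some (k, if f = 3 then fold (d k.1) else (fold (d k.1))⁻¹)

theorem layer_spec : ∀ d f, (layer d f)⁻¹ = layer d f ∧ layer d (layer d f f) = layer d f ∧
    (layer d f f = 0 ∨ layer d f f = 2 ↔ ¬ (f = 0 ∨ f = 2)) := by
  decide

theorem fold_spec : ∀ d, fold d 3 = 1 ∧ (fold d)⁻¹ 1 = 3 := by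
  decide

theorem glue_symm (n : ℕ) (d : ℕ → Bool) (t : Fin n) (f : Fin 4) (t' : Fin n)
    (σ : Equiv.Perm (Fin 4)) (h : glue n d t f = some (t', σ)) :
    glue n d t' (σ f) = some (t, σ⁻¹) := by
  obtain ⟨t, ht⟩ := t
  by_cases hf : f = 0 ∨ f = 2
  · by_cases h0 : 0 < t
    · simp only [glue, hf, h0, if_true, Option.some.injEq, Prod.mk.injEq] at h
      obtain ⟨rfl, rfl⟩ := h
      obtain ⟨h1, h2, h3⟩ := layer_spec (d (t - 1)) f
      have h4 : ¬ (layer (d (t - 1)) f f = 0 ∨ layer (d (t - 1)) f f = 2) := by tauto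
      have h5 : t - 1 + 1 < n := by omega
      have h6 : t - 1 + 1 = t := by omega
      simp only [glue, h4, if_false, h6, ht, dif_pos, h2, h1]
    · simp [glue, hf, h0] at h
  · by_cases hn : t + 1 < n
    · simp only [glue, hf, hn, if_false, dif_pos, Option.some.injEq, Prod.mk.injEq] at h
      obtain ⟨rfl, rfl⟩ := h
      obtain ⟨h1, h2, h3⟩ := layer_spec (d t) f
      have h4 : layer (d t) f f = 0 ∨ layer (d t) f f = 2 := by tauto
      simp only [glue, h4, if_true, Nat.succ_pos, Nat.add_sub_cancel, h2, h1]
    · simp only [glue, hf, hn, if_false, dite_false, Option.some.injEq, Prod.mk.injEq] at h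
      obtain ⟨rfl, rfl⟩ := h
      obtain ⟨h1, h2⟩ := fold_spec (d t)
      have h13 : f = 1 ∨ f = 3 := by
        revert hf; revert f; decide
      rcases h13 with rfl | rfl
      · simp [glue, h2, hn]
      · simp [glue, h1, hn]

theorem glue_ne (n : ℕ) (d : ℕ → Bool) (t : Fin n) (f : Fin 4) (t' : Fin n)
    (σ : Equiv.Perm (Fin 4)) (h : glue n d t f = some (t', σ)) : (t', σ f) ≠ (t, f) := by
  obtain ⟨t, ht⟩ := t
  by_cases hf : f = 0 ∨ f = 2
  · by_cases h0 : 0 < t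
    · simp only [glue, hf, h0, if_true, Option.some.injEq, Prod.mk.injEq] at h
      obtain ⟨rfl, rfl⟩ := h
      simp only [ne_eq, Prod.mk.injEq, Fin.mk.injEq, not_and]
      omega
    · simp [glue, hf, h0] at h
  · by_cases hn : t + 1 < n
    · simp only [glue, hf, hn, if_false, dif_pos, Option.some.injEq, Prod.mk.injEq] at h
      obtain ⟨rfl, rfl⟩ := h
      simp
    · simp only [glue, hf, hn, if_false, dite_false, Option.some.injEq, Prod.mk.injEq] at h
      obtain ⟨rfl, rfl⟩ := h
      obtain ⟨h1, h2⟩ := fold_spec (d t)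
      have h13 : f = 1 ∨ f = 3 := by
        revert hf; revert f; decide
      rcases h13 with rfl | rfl
      · simp [h2]
      · simp [h1]

/-- The triangulation consisting of `n` layered tetrahedra, folded up at the end. -/
def triangulation (n : ℕ) (d : ℕ → Bool) : IdealTriangulation (Fin n) where
  glue := glue n d
  glue_symm := glue_symm n d
  glue_ne := glue_ne n d

variable {m : Slope}

/-- Bases `(u, w)` of `ℤ²` for the successive tetrahedra along a Farey path whose initial triangle has
the vertices `p, q, r` and which leaves it through the edge `pq`.  The `k`-th tetrahedron
(`k = 0, 1, …`) effects the exchange from the triangle `T_k` to the triangle `T_{k+1}`: the slopes of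
`u` and `w` are those common to both, the slope of `u - w` is the one removed and that of `u + w` the
new one. -/
def frame (p q r : Slope) (γ : FareyPath {p, q, r} m) : ℕ → (ℤ × ℤ) × (ℤ × ℤ)
  | 0 => if Slope.ofVec (p.vec - q.vec) = r then (p.vec, q.vec) else (p.vec, -q.vec)
  | k + 1 =>
    let b := frame p q r γ k
    if Slope.ofVec b.1 ∈ γ.tri (k + 2) then (b.1, b.1 + b.2) else (b.1 + b.2, b.2)

/-- Whether the side `u` of the `k`-th tetrahedron is the next slope to disappear. -/
def dropsU (p q r : Slope) (γ : FareyPath {p, q, r} m) (k : ℕ) : Bool :=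
  decide (Slope.ofVec (frame p q r γ k).1 ∉ γ.tri (k + 2))

/-- The lattice point over which a vertex of the `k`-th tetrahedron lies. -/
def pos (p q r : Slope) (γ : FareyPath {p, q, r} m) (k : ℕ) : Fin 4 → ℤ × ℤ :=
  let b := frame p q r γ k
  ![0, b.1, b.1 + b.2, b.2]

/-- The edge `e` of the `k`-th tetrahedron has slope `s`. -/
def HasSlope (p q r : Slope) (γ : FareyPath {p, q, r} m) (k : ℕ) (e : TetEdge) (s : Slope) : Prop :=
  ∃ i j, i ≠ j ∧ e.1 = {i, j} ∧ Slope.ofVec (pos p q r γ k j - pos p q r γ k i) = s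

end LayeredSolidTorus

open LayeredSolidTorus in
/-- The layered solid torus with boundary slopes `p, q, r` and meridian `m`, where the Farey path `γ`
from the triangle `pqr` to `m` leaves this triangle through the edge `pq`: one tetrahedron for each of
the exchanges `T₀ → T₁ → ⋯ → T_{N-1}`, the triangulated torus `T_{N-1}` being folded across its
slope that is not in `T_N`. -/
def layeredSolidTorus (p q r : Slope) {m : Slope} (γ : FareyPath {p, q, r} m) :
    IdealTriangulation (Fin (γ.length - 1)) :=
  triangulation (γ.length - 1) (dropsU p q r γ)

/-- With the dihedral angles `α`, the interior dihedral angle of the layered solid torus at its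
boundary edge of slope `s` is `a`. -/
def HasBoundaryAngle (p q r : Slope) {m : Slope} (γ : FareyPath {p, q, r} m)
    (α : Fin (γ.length - 1) → TetEdge → ℝ) (s : Slope) (a : ℝ) : Prop :=
  ∀ t e f, f ∉ e.1 → (layeredSolidTorus p q r γ).glue t f = none →
    LayeredSolidTorus.HasSlope p q r γ t e s →
    (layeredSolidTorus p q r γ).angleSum α ((layeredSolidTorus p q r γ).edge t e) = a

/-!
Put an exterior angle, `π` minus the interior one, on each edge of the successive punctured tori.
With weights `i(m, ·)`, the exterior angles of a torus add up to a number which strictly decreases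
under each removal of a tetrahedron and equals `2π` for the torus folded flat onto `m`, hence is
larger than `2π` on the boundary. Conversely, if it is larger than `2π` on the boundary, then the
angles of the outermost tetrahedron can be chosen such that it stays larger than `2π` on the next
torus, whose exterior angles satisfy the same inequalities, down to the last tetrahedron, whose
angles are determined by the folding.
-/

/-! ### Slopes and bases of the lattice -/

namespace Slope

theorem ofVec_neg (v : ℤ × ℤ) : ofVec (-v) = ofVec v := by
  by_cases h : v.2 = 0
  · simp [ofVec, h]
  · simp [ofVec, h, neg_div_neg_eq]

theorem ofVec_vec (s : Slope) : ofVec s.vec = s := by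
  induction s using OnePoint.rec with
  | infty => simp [ofVec, vec]
  | coe x =>
    have hden : (x.den : ℤ) ≠ 0 := mod_cast x.den_nz
    simp only [ofVec, vec, OnePoint.elim_some, hden, if_false]
    exact congrArg OnePoint.some (mod_cast x.num_div_den)

/-- The determinant of two lattice vectors; on primitive vectors its absolute value is the
intersection number of their slopes. -/
def det (v w : ℤ × ℤ) : ℤ := v.1 * w.2 - v.2 * w.1

theorem det_neg_left (v w : ℤ × ℤ) : det (-v) w = -det v w := by
  simp only [det, Prod.fst_neg, Prod.snd_neg]; ring

theorem det_neg_right (v w : ℤ × ℤ) : det v (-w) = -det v w := by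
  simp only [det, Prod.fst_neg, Prod.snd_neg]; ring

theorem inter_eq_natAbs_det {s t : Slope} {v w : ℤ × ℤ} (hs : s.vec = v ∨ s.vec = -v)
    (ht : t.vec = w ∨ t.vec = -w) : inter s t = (det v w).natAbs := by
  change (det s.vec t.vec).natAbs = _
  rcases hs with hs | hs <;> rcases ht with ht | ht <;>
    simp only [hs, ht, det_neg_left, det_neg_right, Int.natAbs_neg]

theorem det_smul_eq (v w z : ℤ × ℤ) : det v w • z = det z w • v + det v z • w := by
  ext <;> simp only [det, Prod.smul_fst, Prod.smul_snd, Prod.fst_add, Prod.snd_add, smul_eq_mul] <;>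
    ring

/-- The lattice vectors `v` and `w` form a basis of `ℤ²`. -/
def IsLatticeBasis (v w : ℤ × ℤ) : Prop := IsUnit (det v w)

namespace IsLatticeBasis

variable {v w : ℤ × ℤ}

theorem of_inter {s t : Slope} (h : inter s t = 1) : IsLatticeBasis s.vec t.vec :=
  Int.isUnit_iff_natAbs_eq.2 h

theorem natAbs_det (h : IsLatticeBasis v w) : (det v w).natAbs = 1 :=
  Int.isUnit_iff_natAbs_eq.1 h

theorem symm (h : IsLatticeBasis v w) : IsLatticeBasis w v := by
  have hdet : det w v = -det v w := by simp only [det]; ring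
  rw [IsLatticeBasis, hdet]
  exact IsUnit.neg h

theorem neg_right (h : IsLatticeBasis v w) : IsLatticeBasis v (-w) := by
  rw [IsLatticeBasis, det_neg_right]
  exact IsUnit.neg h

theorem add_right (h : IsLatticeBasis v w) : IsLatticeBasis v (v + w) := by
  have hdet : det v (v + w) = det v w := by simp only [det, Prod.fst_add, Prod.snd_add]; ring
  rwa [IsLatticeBasis, hdet]

theorem add_left (h : IsLatticeBasis v w) : IsLatticeBasis (v + w) w :=
  (add_comm w v ▸ h.symm.add_right).symm

theorem sub_right (h : IsLatticeBasis v w) : IsLatticeBasis v (v - w) :=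
  sub_eq_add_neg v w ▸ h.neg_right.add_right

theorem isCoprime_left (h : IsLatticeBasis v w) : IsCoprime v.1 v.2 := by
  rcases Int.isUnit_iff.1 h with h | h <;> simp only [det] at h
  · exact ⟨w.2, -w.1, by linarith⟩
  · exact ⟨-w.2, w.1, by linarith⟩

theorem vec_left (h : IsLatticeBasis v w) : (ofVec v).vec = v ∨ (ofVec v).vec = -v :=
  vec_ofVec h.isCoprime_left

theorem vec_right (h : IsLatticeBasis v w) : (ofVec w).vec = w ∨ (ofVec w).vec = -w :=
  h.symm.vec_left

theorem ofVec_ne (h : IsLatticeBasis v w) : ofVec v ≠ ofVec w := fun heq => by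
  have hinter : inter (ofVec v) (ofVec w) = 1 :=
    (inter_eq_natAbs_det h.vec_left h.vec_right).trans h.natAbs_det
  rw [heq, inter_self] at hinter
  exact zero_ne_one hinter

theorem eq_ofVec_add_or_sub (h : IsLatticeBasis v w) {s : Slope} (hv : inter s (ofVec v) = 1)
    (hw : inter s (ofVec w) = 1) : s = ofVec (v + w) ∨ s = ofVec (v - w) := by
  rw [inter_eq_natAbs_det (Or.inl rfl) h.vec_left] at hv
  rw [inter_eq_natAbs_det (Or.inl rfl) h.vec_right] at hw
  have hdet_v : det v s.vec = -det s.vec v := by simp only [det]; ring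
  have hcramer := det_smul_eq v w s.vec
  have hvec : s.vec = v + w ∨ s.vec = -(v + w) ∨ s.vec = v - w ∨ s.vec = -(v - w) := by
    rw [hdet_v] at hcramer
    rcases Int.natAbs_eq_iff.1 h.natAbs_det with h₀ | h₀ <;>
      rcases Int.natAbs_eq_iff.1 hv with h₁ | h₁ <;>
      rcases Int.natAbs_eq_iff.1 hw with h₂ | h₂ <;>
      simp only [h₀, h₁, h₂, Nat.cast_one, neg_neg, one_smul, neg_smul, neg_eq_iff_eq_neg]
        at hcramer <;>
      rw [hcramer] <;> simp [sub_eq_add_neg, add_comm]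
  rw [← ofVec_vec s]
  rcases hvec with h | h | h | h <;> simp only [h, ofVec_neg, true_or, or_true]

theorem inter_of_vec (h : IsLatticeBasis v w) {s : Slope}
    {x y : ℕ} (hs : s.vec = (y : ℤ) • v + (x : ℤ) • w ∨ s.vec = -((y : ℤ) • v + (x : ℤ) • w)) :
    inter s (ofVec v) = x ∧ inter s (ofVec w) = y ∧ inter s (ofVec (v - w)) = x + y := by
  have hv : det ((y : ℤ) • v + (x : ℤ) • w) v = -x * det v w := by
    simp only [det, Prod.fst_add, Prod.snd_add, Prod.smul_fst, Prod.smul_snd, smul_eq_mul]; ring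
  have hw : det ((y : ℤ) • v + (x : ℤ) • w) w = y * det v w := by
    simp only [det, Prod.fst_add, Prod.snd_add, Prod.smul_fst, Prod.smul_snd, smul_eq_mul]; ring
  have hsub : det ((y : ℤ) • v + (x : ℤ) • w) (v - w) = -(x + y : ℕ) * det v w := by
    simp only [det, Prod.fst_add, Prod.snd_add, Prod.fst_sub, Prod.snd_sub, Prod.smul_fst,
      Prod.smul_snd, smul_eq_mul, Nat.cast_add]
    ring
  rw [inter_eq_natAbs_det hs h.vec_left, inter_eq_natAbs_det hs h.vec_right,
    inter_eq_natAbs_det hs h.sub_right.vec_right, hv, hw, hsub]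
  simp only [Int.natAbs_mul, Int.natAbs_neg, Int.natAbs_natCast, h.natAbs_det, mul_one, and_self]

end IsLatticeBasis

end Slope

open Slope

theorem mem_of_card_triple_inter_eq_two {α : Type*} [DecidableEq α] {a b c : α} {S : Finset α}
    (h : (({a, b, c} : Finset α) ∩ S).card = 2) :
    a ∈ S ∧ b ∈ S ∨ a ∈ S ∧ c ∈ S ∨ b ∈ S ∧ c ∈ S := by
  obtain ⟨x, y, hxy, heq⟩ := Finset.card_eq_two.1 h
  have hx : x ∈ ({a, b, c} : Finset α) ∩ S := by simp [heq]
  have hy : y ∈ ({a, b, c} : Finset α) ∩ S := by simp [heq]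
  grind

namespace IsFareyTriangle

variable {T : Finset Slope} {v w : ℤ × ℤ}

theorem pairwise_ne {p q r : Slope} (h : IsFareyTriangle {p, q, r}) : p ≠ q ∧ p ≠ r ∧ q ≠ r := by
  have hcard := h.1
  grind [Finset.card_le_two]

theorem eq_insert_add_or_sub (hT : IsFareyTriangle T) (h : IsLatticeBasis v w)
    (hv : ofVec v ∈ T) (hw : ofVec w ∈ T) :
    T = {ofVec v, ofVec w, ofVec (v + w)} ∨ T = {ofVec v, ofVec w, ofVec (v - w)} := by
  have hsub : ({ofVec v, ofVec w} : Finset Slope) ⊆ T :=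
    Finset.insert_subset hv (Finset.singleton_subset_iff.2 hw)
  obtain ⟨s, hs, hT_eq⟩ : ∃ s ∉ ({ofVec v, ofVec w} : Finset Slope),
      insert s {ofVec v, ofVec w} = T :=
    Finset.covBy_iff_exists_insert.1 (Finset.covBy_iff_card_sdiff_eq_one.2
      ⟨hsub, by rw [Finset.card_sdiff_of_subset hsub, hT.1, Finset.card_pair h.ofVec_ne]⟩)
  have hsT : s ∈ T := hT_eq ▸ Finset.mem_insert_self _ _
  simp only [Finset.mem_insert, Finset.mem_singleton, not_or] at hs
  have hs_cases := h.eq_ofVec_add_or_sub (hT.2 s hsT _ hv hs.1) (hT.2 s hsT _ hw hs.2)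
  grind

theorem eq_insert_add (hT : IsFareyTriangle T) (h : IsLatticeBasis v w) (hv : ofVec v ∈ T)
    (hw : ofVec w ∈ T) (hsub : ofVec (v - w) ∉ T) :
    T = {ofVec v, ofVec w, ofVec (v + w)} :=
  (hT.eq_insert_add_or_sub h hv hw).resolve_right fun hT_eq => hsub (by simp [hT_eq])

end IsFareyTriangle

/-! ### The bases along a Farey path -/

namespace LayeredSolidTorus

/-- The basis `b = (u, w)` is adapted to the exchange from the Farey triangle `T` to the Farey
triangle `T'`: the slopes of `u` and `w` are the common ones, that of `u - w` is removed and that of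
`u + w` is new. -/
structure IsAdapted (b : (ℤ × ℤ) × (ℤ × ℤ)) (T T' : Finset Slope) : Prop where
  basis : IsLatticeBasis b.1 b.2
  outer : T = {ofVec b.1, ofVec b.2, ofVec (b.1 - b.2)}
  inner : T' = {ofVec b.1, ofVec b.2, ofVec (b.1 + b.2)}

namespace IsAdapted

variable {u w : ℤ × ℤ} {T T' T'' : Finset Slope}

theorem succ (h : IsAdapted (u, w) T T') (hT'' : IsFareyTriangle T'')
    (hcard : (T' ∩ T'').card = 2) (hne : T'' ≠ T) :
    IsAdapted (if ofVec u ∈ T'' then (u, u + w) else (u + w, w)) T' T'' := by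
  obtain ⟨hbasis, houter, hinner⟩ := h
  have hne' : T'' ≠ T' := by
    rintro rfl
    rw [Finset.inter_self, hT''.1] at hcard
    exact absurd hcard (by norm_num)
  have hnot : ¬ (ofVec u ∈ T'' ∧ ofVec w ∈ T'') := fun ⟨hu, hw⟩ =>
    (hT''.eq_insert_add_or_sub hbasis hu hw).elim (fun h => hne' (h.trans hinner.symm))
      fun h => hne (h.trans houter.symm)
  have hpair := mem_of_card_triple_inter_eq_two (hinner ▸ hcard)
  split_ifs with hu
  · have hsub : ofVec (u - (u + w)) = ofVec w := by rw [sub_add_cancel_left, ofVec_neg]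
    exact ⟨hbasis.add_right, by grind, hT''.eq_insert_add hbasis.add_right hu (by tauto)
      (by rw [hsub]; tauto)⟩
  · have hsub : ofVec (u + w - w) = ofVec u := by rw [add_sub_cancel_right]
    exact ⟨hbasis.add_left, by grind, hT''.eq_insert_add hbasis.add_left (by tauto) (by tauto)
      (by rwa [hsub])⟩

end IsAdapted

variable {p q r m : Slope}

theorem frame_succ (γ : FareyPath {p, q, r} m) (k : ℕ) :
    frame p q r γ (k + 1) = if dropsU p q r γ k then
      ((frame p q r γ k).1 + (frame p q r γ k).2, (frame p q r γ k).2) else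
      ((frame p q r γ k).1, (frame p q r γ k).1 + (frame p q r γ k).2) := by
  simp only [frame, dropsU, decide_eq_true_eq, ite_not]

theorem isLatticeBasis_frame_zero (hpqr : IsFareyTriangle {p, q, r})
    (γ : FareyPath {p, q, r} m) :
    IsLatticeBasis (frame p q r γ 0).1 (frame p q r γ 0).2 := by
  have hbasis := IsLatticeBasis.of_inter (hpqr.2 p (by simp) q (by simp) hpqr.pairwise_ne.1)
  unfold frame
  split_ifs
  exacts [hbasis, hbasis.neg_right]

theorem ofVec_frame_zero (hpqr : IsFareyTriangle {p, q, r}) (γ : FareyPath {p, q, r} m) :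
    ofVec (frame p q r γ 0).1 = p ∧ ofVec (frame p q r γ 0).2 = q ∧
      ofVec ((frame p q r γ 0).1 - (frame p q r γ 0).2) = r := by
  obtain ⟨hpq, hpr, hqr⟩ := hpqr.pairwise_ne
  have hr_cases : r = ofVec (p.vec + q.vec) ∨ r = ofVec (p.vec - q.vec) :=
    (IsLatticeBasis.of_inter (hpqr.2 p (by simp) q (by simp) hpq)).eq_ofVec_add_or_sub
      (by rw [ofVec_vec]; exact hpqr.2 r (by simp) p (by simp) hpr.symm)
      (by rw [ofVec_vec]; exact hpqr.2 r (by simp) q (by simp) hqr.symm)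
  unfold frame
  split_ifs with hr
  · exact ⟨ofVec_vec p, ofVec_vec q, hr⟩
  · rw [sub_neg_eq_add, ofVec_neg]
    exact ⟨ofVec_vec p, ofVec_vec q, (hr_cases.resolve_right (Ne.symm hr)).symm⟩

theorem isAdapted_frame_zero (hpqr : IsFareyTriangle {p, q, r}) (γ : FareyPath {p, q, r} m)
    (hN : 0 < γ.length) (hr : r ∉ γ.tri 1) :
    IsAdapted (frame p q r γ 0) (γ.tri 0) (γ.tri 1) := by
  have hbasis := isLatticeBasis_frame_zero hpqr γ
  obtain ⟨hu, hw, hsub⟩ := ofVec_frame_zero hpqr γ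
  have hcard := γ.card_inter 0 hN
  rw [γ.tri_zero] at hcard
  have hpair := mem_of_card_triple_inter_eq_two hcard
  refine ⟨hbasis, by rw [γ.tri_zero, hu, hw, hsub], ?_⟩
  exact (γ.isFareyTriangle 1 hN).eq_insert_add hbasis (by rw [hu]; tauto) (by rw [hw]; tauto)
    (by rwa [hsub])

theorem isAdapted_frame (hpqr : IsFareyTriangle {p, q, r}) (γ : FareyPath {p, q, r} m)
    (hr : r ∉ γ.tri 1) {k : ℕ} (hk : k < γ.length) :
    IsAdapted (frame p q r γ k) (γ.tri k) (γ.tri (k + 1)) := by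
  induction k with
  | zero => exact isAdapted_frame_zero hpqr γ hk hr
  | succ k ih =>
    exact (ih (by omega)).succ (γ.isFareyTriangle (k + 2) hk) (γ.card_inter (k + 1) hk)
      (γ.ne_of_two_steps k hk)

/-- The intersection numbers `(i(m, u), i(m, w))` of the meridian with the sides `u` and `w` of the
first of `n` layered tetrahedra, `d` being as in `glue`. -/
def weight : ℕ → (ℕ → Bool) → ℕ × ℕ
  | 0, _ => (1, 1)
  | n + 1, d =>
    let a := weight n fun k => d (k + 1)
    if d 0 then (a.1 + a.2, a.2) else (a.1, a.1 + a.2)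

theorem eq_ofVec_add_of_length_eq (hpqr : IsFareyTriangle {p, q, r}) (γ : FareyPath {p, q, r} m)
    (hr : r ∉ γ.tri 1) {k : ℕ} (hk : k + 1 = γ.length) :
    m = ofVec ((frame p q r γ k).1 + (frame p q r γ k).2) := by
  obtain ⟨-, houter, hinner⟩ := isAdapted_frame hpqr γ hr (k := k) (by omega)
  have hm := (γ.mem_iff (k + 1) hk.le).2 hk
  have hm' : m ∉ γ.tri k := fun h => by
    have := (γ.mem_iff k (by omega)).1 h
    omega
  rw [hinner] at hm
  rw [houter] at hm'
  simp only [Finset.mem_insert, Finset.mem_singleton] at hm hm'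
  tauto

theorem vec_meridian (hpqr : IsFareyTriangle {p, q, r}) (γ : FareyPath {p, q, r} m)
    (hr : r ∉ γ.tri 1) (j : ℕ) : ∀ k, k + j + 1 = γ.length →
    let a := weight j fun i => dropsU p q r γ (k + i)
    let v := (a.2 : ℤ) • (frame p q r γ k).1 + (a.1 : ℤ) • (frame p q r γ k).2
    m.vec = v ∨ m.vec = -v := by
  induction j with
  | zero =>
    intro k hk
    have hbasis := (isAdapted_frame hpqr γ hr (k := k) (by omega)).basis
    simpa only [weight, Nat.cast_one, one_smul, ← eq_ofVec_add_of_length_eq hpqr γ hr hk]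
      using hbasis.add_right.vec_right
  | succ j ih =>
    intro k hk
    have hweight : (fun i => dropsU p q r γ (k + 1 + i)) = fun i => dropsU p q r γ (k + (i + 1)) :=
      funext fun i => by rw [Nat.add_assoc, Nat.add_comm 1 i]
    have htail := ih (k + 1) (by omega)
    simp only [frame_succ, hweight] at htail
    simp only [weight, Nat.add_zero]
    generalize weight j (fun i => dropsU p q r γ (k + (i + 1))) = a at htail ⊢
    cases hd : dropsU p q r γ k <;> simp only [hd, Bool.false_eq_true, if_true, if_false, smul_add,
      Nat.cast_add, add_smul, neg_add] at htail ⊢ <;> convert htail using 2 <;> abel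

theorem inter_meridian (hpqr : IsFareyTriangle {p, q, r}) (γ : FareyPath {p, q, r} m)
    (hN : 0 < γ.length) (hr : r ∉ γ.tri 1) :
    let a := weight (γ.length - 1) (dropsU p q r γ)
    inter m p = a.1 ∧ inter m q = a.2 ∧ inter m r = a.1 + a.2 := by
  have hm := vec_meridian hpqr γ hr (γ.length - 1) 0 (by omega)
  simp only [Nat.zero_add] at hm
  have hinter := (isLatticeBasis_frame_zero hpqr γ).inter_of_vec hm
  rwa [(ofVec_frame_zero hpqr γ).1, (ofVec_frame_zero hpqr γ).2.1, (ofVec_frame_zero hpqr γ).2.2]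
    at hinter

end LayeredSolidTorus

/-! ### Exterior angles -/

namespace LayeredSolidTorus

theorem one_le_weight (n : ℕ) (d : ℕ → Bool) : 1 ≤ (weight n d).1 ∧ 1 ≤ (weight n d).2 := by
  induction n generalizing d with
  | zero => exact ⟨le_rfl, le_rfl⟩
  | succ n ih =>
    have htail := ih fun k => d (k + 1)
    rw [weight]
    split_ifs <;> dsimp only <;> omega

theorem two_lt_weight_add (n : ℕ) (d : ℕ → Bool) :
    2 < (weight (n + 1) d).1 + (weight (n + 1) d).2 := by
  have htail := one_le_weight n fun k => d (k + 1)
  rw [weight]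
  split_ifs <;> dsimp only <;> omega

/-- The sum `i(m, u) a + i(m, w) b + i(m, u - w) c` of the exterior angles `a, b, c` of `n` layered
tetrahedra, weighted by the intersection numbers with the meridian. -/
noncomputable def meridianSum (n : ℕ) (d : ℕ → Bool) (a b c : ℝ) : ℝ :=
  (weight n d).1 * a + (weight n d).2 * b + ((weight n d).1 + (weight n d).2) * c

/-- `IsPleating n d x y a b c`: `n` layered tetrahedra, the `k`-th of which has the dihedral angles
`x k`, `y k` and `π - x k - y k` at its sides `u`, `w` and at its diagonals, have exterior angles
`a, b, c` at the slopes of `u, w, u - w` of their outer torus. Removing the outermost tetrahedron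
yields the exterior angles of the next torus; that of the new diagonal `u + w` is `-c`. No
tetrahedron being left, the torus is folded flat along the slope of `u - w`, with exterior
angle `π`. -/
def IsPleating : ℕ → (ℕ → Bool) → (ℕ → ℝ) → (ℕ → ℝ) → ℝ → ℝ → ℝ → Prop
  | 0, _, _, _, _, _, c => c = Real.pi
  | n + 1, d, x, y, a, b, c => 0 < x 0 ∧ 0 < y 0 ∧ x 0 + y 0 = c ∧ c < Real.pi ∧
      IsPleating n (fun k => d (k + 1)) (fun k => x (k + 1)) (fun k => y (k + 1))
        (if d 0 then -c else a + 2 * x 0) (if d 0 then b + 2 * y 0 else -c)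
        (if d 0 then a + 2 * x 0 else b + 2 * y 0)

variable {n : ℕ} {d : ℕ → Bool} {a b c : ℝ}

theorem meridianSum_succ_of_true (hd : d 0 = true) (a b s t : ℝ) :
    meridianSum (n + 1) d a b (s + t) =
      meridianSum n (fun k => d (k + 1)) (-(s + t)) (b + 2 * t) (a + 2 * s) +
        2 * (weight n fun k => d (k + 1)).1 * t := by
  simp only [meridianSum, weight, hd, if_true, Nat.cast_add]
  ring

theorem meridianSum_succ_of_false (hd : d 0 = false) (a b s t : ℝ) :
    meridianSum (n + 1) d a b (s + t) =
      meridianSum n (fun k => d (k + 1)) (a + 2 * s) (-(s + t)) (b + 2 * t) +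
        2 * (weight n fun k => d (k + 1)).2 * s := by
  simp only [meridianSum, weight, hd, Bool.false_eq_true, if_false, Nat.cast_add]
  ring

theorem meridianSum_tail_lt {s t : ℝ} (hs : 0 < s) (ht : 0 < t) :
    meridianSum n (fun k => d (k + 1)) (if d 0 then -(s + t) else a + 2 * s)
      (if d 0 then b + 2 * t else -(s + t)) (if d 0 then a + 2 * s else b + 2 * t) <
        meridianSum (n + 1) d a b (s + t) := by
  have hweight := one_le_weight n fun k => d (k + 1)
  have hP : (0 : ℝ) < (weight n fun k => d (k + 1)).1 := mod_cast hweight.1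
  have hQ : (0 : ℝ) < (weight n fun k => d (k + 1)).2 := mod_cast hweight.2
  cases hd : d 0
  · rw [meridianSum_succ_of_false hd]
    exact lt_add_of_pos_right _ (by positivity)
  · rw [meridianSum_succ_of_true hd]
    exact lt_add_of_pos_right _ (by positivity)

namespace IsPleating

variable {x y : ℕ → ℝ}

theorem two_pi_le_meridianSum (h : IsPleating n d x y a b c) (hsum : a + b + c = Real.pi) :
    2 * Real.pi ≤ meridianSum n d a b c := by
  induction n generalizing d x y a b c with
  | zero =>
    change c = Real.pi at h
    simp only [meridianSum, weight, Nat.cast_one]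
    linarith
  | succ n ih =>
    obtain ⟨hx, hy, rfl, -, htail⟩ := h
    exact (ih htail (by split_ifs <;> linarith)).trans (meridianSum_tail_lt hx hy).le

theorem two_pi_lt_meridianSum (h : IsPleating (n + 1) d x y a b c) (hsum : a + b + c = Real.pi) :
    2 * Real.pi < meridianSum (n + 1) d a b c := by
  obtain ⟨hx, hy, rfl, -, htail⟩ := h
  exact (htail.two_pi_le_meridianSum (by split_ifs <;> linarith)).trans_lt
    (meridianSum_tail_lt hx hy)

end IsPleating

theorem exists_angle {P Q : ℝ} (hP : 1 ≤ P) (hQ : 1 ≤ Q) (hPQ : 2 < P + Q)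
    (hsum : a + b + c = Real.pi) (ha : a < Real.pi) (hb : b < Real.pi) (hc : 0 < c)
    (hc' : c < Real.pi)
    (hmeridian : 2 * Real.pi < (P + Q) * a + Q * b + (P + Q + Q) * c) :
    ∃ s t, 0 < s ∧ 0 < t ∧ s + t = c ∧ 0 < a + 2 * s ∧ a + 2 * s < Real.pi ∧
      b + 2 * t < Real.pi ∧
      2 * Real.pi < P * (-c) + Q * (b + 2 * t) + (P + Q) * (a + 2 * s) := by
  have hP0 : 0 < 2 * P := by linarith
  -- The weighted sum is increasing in `s`; it exceeds `2π` as soon as `s` exceeds this bound.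
  set l := (2 * Real.pi - (P * (-c) + Q * (b + 2 * c) + (P + Q) * a)) / (2 * P) with hl
  have hlc : l < c := by rw [hl, div_lt_iff₀ hP0]; nlinarith
  -- For `a + 2 * s = π` the weighted sum is `(P + Q)π + (Q - P)c`, which lies between `(P + Q)π`
  -- and `2Qπ` as `0 < c < π`.
  have hlπ : l < (Real.pi - a) / 2 := by
    have hprod : 0 < (P + Q - 2) * (Real.pi - c) := mul_pos (by linarith) (by linarith)
    have hQc : 0 ≤ (Q - 1) * c := mul_nonneg (by linarith) hc.le
    obtain rfl : b = Real.pi - a - c := by linarith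
    rw [hl, div_lt_iff₀ hP0]
    nlinarith
  have hinterval : max 0 (max ((c - a) / 2) l) < min c ((Real.pi - a) / 2) := by
    rw [lt_min_iff, max_lt_iff, max_lt_iff, max_lt_iff, max_lt_iff]
    exact ⟨⟨hc, by linarith, hlc⟩, by linarith, by linarith, hlπ⟩
  obtain ⟨s, hs, hs'⟩ := exists_between hinterval
  obtain ⟨hs0, hsa, hsl⟩ : 0 < s ∧ (c - a) / 2 < s ∧ l < s := by simpa only [max_lt_iff] using hs
  obtain ⟨hsc, hsπ⟩ := lt_min_iff.1 hs'
  rw [hl, div_lt_iff₀ hP0] at hsl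
  exact ⟨s, c - s, hs0, by linarith, by ring, by linarith, by linarith, by linarith, by linarith⟩

theorem IsPleating.exists_cons {s t : ℝ} (hs : 0 < s) (ht : 0 < t) (hst : s + t = c)
    (hc : c < Real.pi)
    (h : ∃ x y, IsPleating n (fun k => d (k + 1)) x y (if d 0 then -c else a + 2 * s)
      (if d 0 then b + 2 * t else -c) (if d 0 then a + 2 * s else b + 2 * t)) :
    ∃ x y, IsPleating (n + 1) d x y a b c := by
  obtain ⟨x, y, h⟩ := h
  exact ⟨fun k => k.casesOn s x, fun k => k.casesOn t y, hs, ht, hst, hc, h⟩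

theorem exists_isPleating (hsum : a + b + c = Real.pi) (ha : a < Real.pi) (hb : b < Real.pi)
    (hc : 0 < c) (hc' : c < Real.pi) (hmeridian : 2 * Real.pi < meridianSum (n + 1) d a b c) :
    ∃ x y, IsPleating (n + 1) d x y a b c := by
  induction n generalizing d a b c with
  | zero =>
    cases hd : d 0 <;>
      simp only [meridianSum, weight, hd, Bool.false_eq_true, if_false, if_true, Nat.cast_add,
        Nat.cast_one] at hmeridian
    · refine IsPleating.exists_cons (s := c - (Real.pi - b) / 2) (t := (Real.pi - b) / 2)
        (by linarith) (by linarith) (by ring) hc' ⟨fun _ => 0, fun _ => 0, ?_⟩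
      simp only [IsPleating, hd, Bool.false_eq_true, if_false]
      ring
    · refine IsPleating.exists_cons (s := (Real.pi - a) / 2) (t := c - (Real.pi - a) / 2)
        (by linarith) (by linarith) (by ring) hc' ⟨fun _ => 0, fun _ => 0, ?_⟩
      simp only [IsPleating, hd, if_true]
      ring
  | succ n ih =>
    have hweight := one_le_weight (n + 1) fun k => d (k + 1)
    have hP : (1 : ℝ) ≤ (weight (n + 1) fun k => d (k + 1)).1 := mod_cast hweight.1
    have hQ : (1 : ℝ) ≤ (weight (n + 1) fun k => d (k + 1)).2 := mod_cast hweight.2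
    have hPQ : (2 : ℝ) < (weight (n + 1) fun k => d (k + 1)).1 +
        (weight (n + 1) fun k => d (k + 1)).2 := mod_cast two_lt_weight_add n _
    rw [meridianSum, weight] at hmeridian
    cases hd : d 0 <;>
      simp only [hd, Bool.false_eq_true, if_false, if_true, Nat.cast_add] at hmeridian
    · obtain ⟨t, s, ht, hs, hts, hpos, hlt, hlt', hsum'⟩ := exists_angle (a := b) (b := a) hQ hP
        (by linarith) (by linarith) hb ha hc hc' (by linarith)
      refine IsPleating.exists_cons hs ht (by linarith) hc' ?_
      simp only [hd, Bool.false_eq_true, if_false]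
      exact ih (by linarith) hlt' (by linarith) hpos hlt (by rw [meridianSum]; linarith)
    · obtain ⟨s, t, hs, ht, hst, hpos, hlt, hlt', hsum'⟩ := exists_angle hP hQ hPQ hsum ha hb hc
        hc' hmeridian
      refine IsPleating.exists_cons hs ht hst hc' ?_
      simp only [hd, if_true]
      exact ih (by linarith) (by linarith) hlt' hpos hlt hsum'

theorem exists_isPleating_iff (hsum : a + b + c = Real.pi) (ha : a < Real.pi) (hb : b < Real.pi)
    (hc : 0 < c) (hc' : c < Real.pi) :
    (∃ x y, IsPleating (n + 1) d x y a b c) ↔ 2 * Real.pi < meridianSum (n + 1) d a b c :=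
  ⟨fun ⟨_, _, h⟩ => h.two_pi_lt_meridianSum hsum, exists_isPleating hsum ha hb hc hc'⟩

end LayeredSolidTorus

/-! ### Edge classes -/

namespace TetEdge

/-- The kind of an edge of a layered tetrahedron with vertices over `0, u, u + w, w`: `0` for the
sides `u`, `1` for the sides `w`, `2` for the outer diagonal `u - w` and `3` for the inner diagonal
`u + w`. -/
def kind (e : TetEdge) : Fin 4 :=
  if e.1 = {0, 1} ∨ e.1 = {2, 3} then 0
  else if e.1 = {0, 3} ∨ e.1 = {1, 2} then 1
  else if e.1 = {1, 3} then 2 else 3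

/-- A representative of the edges of a given kind. -/
def ofKind : Fin 4 → TetEdge :=
  ![⟨{0, 1}, rfl⟩, ⟨{0, 3}, rfl⟩, ⟨{1, 3}, rfl⟩, ⟨{0, 2}, rfl⟩]

theorem kind_ofKind : ∀ c, (ofKind c).kind = c := by decide

theorem eq_ofKind_two : ∀ e : TetEdge, e.kind = 2 → e = ofKind 2 := by decide

theorem eq_ofKind_or_opp : ∀ e : TetEdge,
    e = ofKind (![0, 1, 2, 2] e.kind) ∨ e = (ofKind (![0, 1, 2, 2] e.kind)).opp := by decide

theorem kind_opp : ∀ e : TetEdge, e.opp.kind = (![0, 1, 3, 2] : Fin 4 → Fin 4) e.kind := by decide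

theorem sum_kind (g : Fin 4 → ℝ) :
    ∑ e : TetEdge, g e.kind = 2 * g 0 + 2 * g 1 + g 2 + g 3 := by
  have huniv : (Finset.univ : Finset TetEdge) = {⟨{0, 1}, rfl⟩, ⟨{2, 3}, rfl⟩, ⟨{0, 3}, rfl⟩,
      ⟨{1, 2}, rfl⟩, ⟨{1, 3}, rfl⟩, ⟨{0, 2}, rfl⟩} := by decide
  rw [huniv, Finset.sum_insert (by decide), Finset.sum_insert (by decide),
    Finset.sum_insert (by decide), Finset.sum_insert (by decide), Finset.sum_insert (by decide),
    Finset.sum_singleton]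
  change g 0 + (g 0 + (g 1 + (g 1 + (g 2 + g 3)))) = _
  ring

theorem sum_kind_of_mem {g : Fin 4 → ℝ} (hg : g 2 = g 3) (v : Fin 4) :
    ∑ e : TetEdge with v ∈ e.1, g e.kind = g 0 + g 1 + g 2 := by
  have hfilter : ∀ v : Fin 4, ∃ e₀ e₁ e₂ : TetEdge, e₀ ∉ ({e₁, e₂} : Finset TetEdge) ∧ e₁ ≠ e₂ ∧
      Finset.univ.filter (fun e : TetEdge => v ∈ e.1) = {e₀, e₁, e₂} ∧
      e₀.kind = 0 ∧ e₁.kind = 1 ∧ (e₂.kind = 2 ∨ e₂.kind = 3) := by decide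
  obtain ⟨e₀, e₁, e₂, h₀, h₁, h, hk₀, hk₁, hk₂⟩ := hfilter v
  have hg₂ : g e₂.kind = g 2 := by rcases hk₂ with hk | hk <;> rw [hk, hg]
  rw [h, Finset.sum_insert h₀, Finset.sum_pair h₁, hk₀, hk₁, hg₂, add_assoc]

end TetEdge

namespace LayeredSolidTorus

open TetEdge

/-- The kind in a tetrahedron of an edge of kind `c ≠ 3` of the next tetrahedron; `d` tells whether
the side `u` is the one exchanged. -/
def prevKind (d : Bool) : Fin 4 → Fin 4 :=
  if d then ![3, 1, 0, 3] else ![0, 3, 1, 3]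

/-- The identification of kinds in the last tetrahedron by the folding, which makes the slope of
`u + w` homotopic to that of a side. -/
def foldKind (d : Bool) : Fin 4 → Fin 4 :=
  if d then ![0, 1, 2, 1] else ![0, 1, 2, 0]

theorem prevKind_inj : ∀ {d : Bool} {c c' : Fin 4}, c ≠ 3 → c' ≠ 3 →
    prevKind d c = prevKind d c' → c = c' := by decide

theorem prevKind_ne_two : ∀ (d : Bool) (c : Fin 4), prevKind d c ≠ 2 := by decide

theorem foldKind_of_ne : ∀ (d : Bool) {c : Fin 4}, c ≠ 3 → foldKind d c = c := by decide

theorem foldKind_ne_three : ∀ (d : Bool) (c : Fin 4), foldKind d c ≠ 3 := by decide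

theorem kind_layer_of_inner : ∀ (d : Bool) {f : Fin 4} {e : TetEdge}, ¬ (f = 0 ∨ f = 2) → f ∉ e.1 →
    (e.map (layer d f)).kind ≠ 3 ∧ prevKind d (e.map (layer d f)).kind = e.kind := by
  decide

theorem kind_layer_of_outer : ∀ (d : Bool) {f : Fin 4} {e : TetEdge}, f = 0 ∨ f = 2 → f ∉ e.1 →
    e.kind ≠ 3 ∧ (e.map (layer d f)).kind = prevKind d e.kind := by
  decide

theorem foldKind_kind_fold : ∀ (d : Bool) {f : Fin 4} {e : TetEdge}, ¬ (f = 0 ∨ f = 2) → f ∉ e.1 →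
    foldKind d (e.map (if f = 3 then fold d else (fold d)⁻¹)).kind = foldKind d e.kind := by
  decide

theorem kind_ne_three_of_outer : ∀ {f : Fin 4} {e : TetEdge}, f = 0 ∨ f = 2 → f ∉ e.1 →
    e.kind ≠ 3 := by
  decide

theorem exists_outer_face : ∀ {c : Fin 4}, c ≠ 3 → ∃ f : Fin 4, (f = 0 ∨ f = 2) ∧
    f ∉ (ofKind c).1 := by
  decide

/-- The label of the slope of kind `c` in the `k`-th tetrahedron: the boundary slopes have the
labels `0, 1, 2`, and the slope that is new in the `k`-th exchange has the label `k + 3`. -/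
def slopeLabel (d : ℕ → Bool) : ℕ → Fin 4 → ℕ
  | 0, c => c
  | k + 1, c => if c = 3 then k + 4 else slopeLabel d k (prevKind (d k) c)

/-- The label of an edge of kind `c` of the `k`-th of `n` tetrahedra, which is the label of its
slope up to the folding of the last tetrahedron. -/
def label (n : ℕ) (d : ℕ → Bool) (k : ℕ) (c : Fin 4) : ℕ :=
  slopeLabel d k (if k + 1 < n then c else foldKind (d k) c)

variable {n k : ℕ} {d : ℕ → Bool} {c : Fin 4}

theorem slopeLabel_three (d : ℕ → Bool) (k : ℕ) : slopeLabel d k 3 = k + 3 := by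
  cases k <;> rfl

theorem slopeLabel_succ (hc : c ≠ 3) : slopeLabel d (k + 1) c = slopeLabel d k (prevKind (d k) c) :=
  if_neg hc

theorem slopeLabel_le (d : ℕ → Bool) (k : ℕ) (c : Fin 4) : slopeLabel d k c ≤ k + 3 := by
  induction k generalizing c with
  | zero => exact Nat.le_of_lt_succ c.isLt
  | succ k ih =>
    by_cases hc : c = 3
    · rw [hc, slopeLabel_three]
    · exact slopeLabel_succ (d := d) hc ▸ (ih _).trans (Nat.le_succ _)

theorem slopeLabel_injective (d : ℕ → Bool) (k : ℕ) : Function.Injective (slopeLabel d k) := by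
  induction k with
  | zero => exact Fin.val_injective
  | succ k ih =>
    have hlt : ∀ {c}, c ≠ 3 → slopeLabel d (k + 1) c < k + 1 + 3 := fun hc =>
      slopeLabel_succ (d := d) hc ▸ Nat.lt_succ_of_le (slopeLabel_le d k _)
    intro c c' h
    by_cases hc : c = 3 <;> by_cases hc' : c' = 3
    · rw [hc, hc']
    · exact absurd h (by rw [hc, slopeLabel_three]; exact (hlt hc').ne')
    · exact absurd h (by rw [hc', slopeLabel_three]; exact (hlt hc).ne)
    · rw [slopeLabel_succ hc, slopeLabel_succ hc'] at h
      exact prevKind_inj hc hc' (ih h)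

theorem slopeLabel_lt (hc : c ≠ 3) : slopeLabel d k c < k + 3 :=
  (slopeLabel_le d k c).lt_of_ne fun h => hc (slopeLabel_injective d k (h.trans
    (slopeLabel_three d k).symm))

theorem slopeLabel_ne_slopeLabel_two (d : ℕ → Bool) {i : ℕ} (hki : k < i) (c : Fin 4) :
    slopeLabel d i c ≠ slopeLabel d k 2 := by
  induction i, hki using Nat.le_induction generalizing c with
  | base =>
    by_cases hc : c = 3
    · have := slopeLabel_le d k 2
      rw [hc, slopeLabel_three]
      omega
    · rw [slopeLabel_succ hc]
      exact (slopeLabel_injective d k).ne (prevKind_ne_two _ c)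
  | succ i hki ih =>
    by_cases hc : c = 3
    · have := slopeLabel_le d k 2
      rw [hc, slopeLabel_three]
      omega
    · rw [slopeLabel_succ hc]
      exact ih _

theorem label_of_lt (hk : k + 1 < n) (c : Fin 4) : label n d k c = slopeLabel d k c := by
  rw [label, if_pos hk]

theorem label_last (k : ℕ) (c : Fin 4) :
    label (k + 1) d k c = slopeLabel d k (foldKind (d k) c) := by
  rw [label, if_neg (lt_irrefl _)]

theorem label_of_ne (hc : c ≠ 3) : label n d k c = slopeLabel d k c := by
  rw [label, foldKind_of_ne _ hc, ite_self]

theorem label_lt (hk : k < n) (c : Fin 4) : label n d k c < n + 2 := by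
  obtain hk' | rfl : k + 1 < n ∨ n = k + 1 := by omega
  · have := slopeLabel_le d k c
    rw [label_of_lt hk']
    omega
  · rw [label_last]
    exact slopeLabel_lt (foldKind_ne_three _ c)

theorem label_succ (hk : k + 1 < n) (hc : c ≠ 3) :
    label n d (k + 1) c = label n d k (prevKind (d k) c) := by
  rw [label_of_ne hc, label_of_lt hk, slopeLabel_succ hc]

theorem label_kind_eq_of_edgeStep {a b : Fin n × TetEdge}
    (h : (triangulation n d).EdgeStep a b) :
    label n d a.1 a.2.kind = label n d b.1 b.2.kind := by
  obtain ⟨⟨k, hk⟩, e⟩ := a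
  obtain ⟨t, e'⟩ := b
  obtain ⟨f, σ, hf, hglue, rfl : e' = _⟩ := h
  change glue n d ⟨k, hk⟩ f = some (t, σ) at hglue
  unfold glue at hglue
  split_ifs at hglue with hf2 hpos hlast hf3
  · obtain ⟨rfl, rfl⟩ := Prod.mk.inj (Option.some.inj hglue)
    obtain ⟨k, rfl⟩ := Nat.exists_eq_add_one.2 hpos
    obtain ⟨hne, heq⟩ := kind_layer_of_outer (d k) hf2 hf
    exact (label_succ hk hne).trans (congrArg _ heq.symm)
  · obtain ⟨rfl, rfl⟩ := Prod.mk.inj (Option.some.inj hglue)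
    obtain ⟨hne, heq⟩ := kind_layer_of_inner (d k) hf2 hf
    exact ((label_succ hlast hne).trans (congrArg _ heq)).symm
  all_goals
    obtain ⟨rfl, rfl⟩ := Prod.mk.inj (Option.some.inj hglue)
    have hfold := foldKind_kind_fold (d k) hf2 hf
    simp only [hf3, if_true, if_false] at hfold
    simp only [label, hlast, if_false, hfold]

theorem edge_eq_layer (hk : k + 1 < n) {f : Fin 4} (hf2 : ¬ (f = 0 ∨ f = 2)) {e : TetEdge}
    (hf : f ∉ e.1) : (triangulation n d).edge ⟨k, Nat.lt_of_succ_lt hk⟩ e =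
      (triangulation n d).edge ⟨k + 1, hk⟩ (e.map (layer (d k) f)) :=
  Quot.sound ⟨f, layer (d k) f, hf, by simp only [triangulation, glue, hf2, hk, if_false, dif_pos],
    rfl⟩

theorem edge_eq_fold {f : Fin 4} (hf2 : ¬ (f = 0 ∨ f = 2)) {e : TetEdge} (hf : f ∉ e.1) :
    (triangulation (k + 1) d).edge (Fin.last k) e = (triangulation (k + 1) d).edge (Fin.last k)
      (e.map (if f = 3 then fold (d k) else (fold (d k))⁻¹)) :=
  Quot.sound ⟨f, _, hf, by simp [triangulation, glue, hf2], rfl⟩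

theorem edge_last (d : ℕ → Bool) (k : ℕ) (e : TetEdge) :
    (triangulation (k + 1) d).edge (Fin.last k) e =
      (triangulation (k + 1) d).edge (Fin.last k) (ofKind (foldKind (d k) e.kind)) := by
  let move (b : Bool) (f : Fin 4) (e : TetEdge) : TetEdge :=
    if ¬ (f = 0 ∨ f = 2) ∧ f ∉ e.1 then e.map (if f = 3 then fold b else (fold b)⁻¹) else e
  have edge_move (f : Fin 4) (e : TetEdge) : (triangulation (k + 1) d).edge (Fin.last k) e =
      (triangulation (k + 1) d).edge (Fin.last k) (move (d k) f e) := by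
    by_cases hf : ¬ (f = 0 ∨ f = 2) ∧ f ∉ e.1
    · rw [edge_eq_fold hf.1 hf.2, show move (d k) f e = _ from if_pos hf]
    · rw [show move (d k) f e = e from if_neg hf]
  have exists_moves : ∀ (b : Bool) (e : TetEdge), ∃ f f',
      move b f' (move b f e) = ofKind (foldKind b e.kind) := by decide
  obtain ⟨f, f', h⟩ := exists_moves (d k) e
  rw [edge_move f e, edge_move f' _, h]

theorem edge_eq_of_kind_eq (d : ℕ → Bool) (hk : k < n) {e e' : TetEdge} (h : e.kind = e'.kind) :
    (triangulation n d).edge ⟨k, hk⟩ e = (triangulation n d).edge ⟨k, hk⟩ e' := by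
  have exists_inner_face : ∀ e : TetEdge, e.kind ≠ 2 →
      ∃ f : Fin 4, ¬ (f = 0 ∨ f = 2) ∧ f ∉ e.1 := by decide
  obtain ⟨j, hj⟩ := Nat.exists_eq_add_of_lt hk
  induction j generalizing k e e' with
  | zero =>
    obtain rfl : n = k + 1 := hj
    exact (edge_last d k e).trans (h ▸ (edge_last d k e').symm)
  | succ j ih =>
    by_cases h2 : e.kind = 2
    · rw [eq_ofKind_two e h2, eq_ofKind_two e' (h ▸ h2)]
    obtain ⟨f, hf2, hf⟩ := exists_inner_face e h2
    obtain ⟨f', hf2', hf'⟩ := exists_inner_face e' (h ▸ h2)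
    obtain ⟨hne, heq⟩ := kind_layer_of_inner (d k) hf2 hf
    obtain ⟨hne', heq'⟩ := kind_layer_of_inner (d k) hf2' hf'
    have hk' : k + 1 < n := by omega
    rw [edge_eq_layer hk' hf2 hf, edge_eq_layer hk' hf2' hf']
    exact ih hk' (prevKind_inj hne hne' (heq.trans (h.trans heq'.symm))) (by omega)

theorem edge_ofKind_succ (hk : k + 1 < n) (hc : c ≠ 3) :
    (triangulation n d).edge ⟨k + 1, hk⟩ (ofKind c) =
      (triangulation n d).edge ⟨k, Nat.lt_of_succ_lt hk⟩ (ofKind (prevKind (d k) c)) := by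
  have exists_inner_face : ∀ (b : Bool) (c : Fin 4), c ≠ 3 → ∃ f : Fin 4, ¬ (f = 0 ∨ f = 2) ∧
      f ∉ (ofKind (prevKind b c)).1 ∧ (ofKind (prevKind b c)).map (layer b f) = ofKind c := by
    decide
  obtain ⟨f, hf2, hf, hmap⟩ := exists_inner_face (d k) c hc
  rw [edge_eq_layer hk hf2 hf, hmap]

theorem edge_ofKind_eq_of_slopeLabel_eq {i : ℕ} (hik : i ≤ k) (hk : k < n) {c c' : Fin 4}
    (h : slopeLabel d k c = slopeLabel d i c') :
    (triangulation n d).edge ⟨k, hk⟩ (ofKind c) =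
      (triangulation n d).edge ⟨i, hik.trans_lt hk⟩ (ofKind c') := by
  induction k, hik using Nat.le_induction generalizing c with
  | base => rw [slopeLabel_injective d i h]
  | succ k hik ih =>
    have hc : c ≠ 3 := by
      rintro rfl
      have := slopeLabel_le d i c'
      rw [slopeLabel_three] at h
      omega
    rw [edge_ofKind_succ hk hc, ih _ (slopeLabel_succ (d := d) hc ▸ h)]

theorem edge_eq_ofKind (k : Fin n) (e : TetEdge) : (triangulation n d).edge k e =
    (triangulation n d).edge k (ofKind (if k + 1 < n then e.kind else foldKind (d k) e.kind)) := by
  obtain ⟨k, hk⟩ := k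
  obtain hk' | rfl : k + 1 < n ∨ n = k + 1 := by omega
  · rw [if_pos hk']
    exact edge_eq_of_kind_eq d hk (kind_ofKind _).symm
  · rw [if_neg (lt_irrefl _)]
    exact edge_last d k e

theorem edge_eq_iff {t t' : Fin n} {e e' : TetEdge} :
    (triangulation n d).edge t e = (triangulation n d).edge t' e' ↔
      label n d t e.kind = label n d t' e'.kind := by
  constructor
  · exact congrArg (Quot.lift (fun a : Fin n × TetEdge => label n d a.1 a.2.kind)
      fun _ _ => label_kind_eq_of_edgeStep)
  · intro h
    rw [edge_eq_ofKind t, edge_eq_ofKind t']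
    rcases le_total t t' with htt' | htt'
    · exact (edge_ofKind_eq_of_slopeLabel_eq htt' t'.isLt h.symm).symm
    · exact edge_ofKind_eq_of_slopeLabel_eq htt' t.isLt h

theorem glue_eq_none_iff {t : Fin n} {f : Fin 4} :
    (triangulation n d).glue t f = none ↔ t.1 = 0 ∧ (f = 0 ∨ f = 2) := by
  change glue n d t f = none ↔ _
  unfold glue
  split_ifs with hf hpos hlast
  · simp only [hpos.ne', false_and]
  · simp only [hf, Nat.eq_zero_of_not_pos hpos, true_and]
  · simp only [hf, and_false]
  · simp only [hf, and_false]

theorem isBoundaryEdge_iff {t : Fin n} {e : TetEdge} :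
    (triangulation n d).IsBoundaryEdge ((triangulation n d).edge t e) ↔
      label n d t e.kind < 3 := by
  constructor
  · rintro ⟨t', e', f, heq, hf, hglue⟩
    obtain ⟨ht', hf2⟩ := glue_eq_none_iff.1 hglue
    rw [← edge_eq_iff.1 heq, ht', label_of_ne (kind_ne_three_of_outer hf2 hf)]
    exact slopeLabel_lt (kind_ne_three_of_outer hf2 hf)
  · intro h
    obtain ⟨c, hc⟩ : ∃ c : Fin 4, c.1 = label n d t e.kind := ⟨⟨_, h.trans (by decide)⟩, rfl⟩
    have hc3 : c ≠ 3 := by rintro rfl; exact absurd (hc ▸ h) (by decide)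
    obtain ⟨f, hf2, hf⟩ := exists_outer_face hc3
    refine ⟨⟨0, t.pos⟩, ofKind c, f, edge_eq_iff.2 ?_, hf, glue_eq_none_iff.2 ⟨rfl, hf2⟩⟩
    rw [kind_ofKind, label_of_ne hc3, ← hc, slopeLabel]

end LayeredSolidTorus

/-! ### Angle structures -/

namespace LayeredSolidTorus

open TetEdge

/-- The dihedral angle at the edges of a given kind in a tetrahedron with the angles `x`, `y` at the
sides `u`, `w`. -/
noncomputable def kindAngle (x y : ℝ) : Fin 4 → ℝ :=
  ![x, y, Real.pi - x - y, Real.pi - x - y]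

/-- The sum of the angles at the edges with label `j` of the `k`-th tetrahedron. -/
noncomputable def labelAngle (n : ℕ) (d : ℕ → Bool) (x y : ℕ → ℝ) (k j : ℕ) : ℝ :=
  ∑ e : TetEdge, if label n d k e.kind = j then kindAngle (x k) (y k) e.kind else 0

/-- The sum of the angles at the edges with label `j` of all tetrahedra from the `k`-th on. -/
noncomputable def innerAngleSum (n : ℕ) (d : ℕ → Bool) (x y : ℕ → ℝ) (k j : ℕ) : ℝ :=
  ∑ i ∈ Finset.Ico k n, labelAngle n d x y i j

variable {n k : ℕ} {d : ℕ → Bool} {x y : ℕ → ℝ} {a b c : ℝ}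

theorem angleSum_eq_innerAngleSum (t : Fin n) (e : TetEdge) :
    (triangulation n d).angleSum (fun t e => kindAngle (x t) (y t) e.kind)
        ((triangulation n d).edge t e) = innerAngleSum n d x y 0 (label n d t e.kind) := by
  rw [innerAngleSum, ← Finset.range_eq_Ico, ← Fin.sum_univ_eq_sum_range]
  simp only [IdealTriangulation.angleSum, edge_eq_iff, labelAngle]

theorem innerAngleSum_eq_add (hk : k < n) (j : ℕ) :
    innerAngleSum n d x y k j = labelAngle n d x y k j + innerAngleSum n d x y (k + 1) j :=
  Finset.sum_eq_sum_Ico_succ_bot hk _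

theorem labelAngle_eq (n : ℕ) (d : ℕ → Bool) (x y : ℕ → ℝ) (k j : ℕ) : labelAngle n d x y k j =
    (if label n d k 0 = j then 2 * x k else 0) + (if label n d k 1 = j then 2 * y k else 0) +
      (if label n d k 2 = j then Real.pi - x k - y k else 0) +
      (if label n d k 3 = j then Real.pi - x k - y k else 0) := by
  rw [labelAngle, sum_kind fun c => if label n d k c = j then kindAngle (x k) (y k) c else 0]
  simp only [kindAngle, Matrix.cons_val, mul_ite, mul_zero]

theorem innerAngleSum_slopeLabel (hk : k + 1 < n) (c : Fin 4) :
    innerAngleSum n d x y k (slopeLabel d k c) =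
      ![2 * x k, 2 * y k, Real.pi - x k - y k, Real.pi - x k - y k] c +
        innerAngleSum n d x y (k + 1) (slopeLabel d k c) := by
  rw [innerAngleSum_eq_add (Nat.lt_of_succ_lt hk), labelAngle_eq]
  simp only [label_of_lt hk, (slopeLabel_injective d k).eq_iff]
  fin_cases c <;> simp

theorem innerAngleSum_slopeLabel_last (x y : ℕ → ℝ) (d : ℕ → Bool) (k : ℕ) (c : Fin 4) :
    innerAngleSum (k + 1) d x y k (slopeLabel d k c) =
      ![if d k then 2 * x k else Real.pi + x k - y k, if d k then Real.pi + y k - x k else 2 * y k,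
        Real.pi - x k - y k, 0] c := by
  rw [innerAngleSum, Nat.Ico_succ_singleton, Finset.sum_singleton, labelAngle_eq]
  simp only [label_last, (slopeLabel_injective d k).eq_iff]
  cases d k <;> fin_cases c <;> simp [foldKind] <;> ring

theorem innerAngleSum_slopeLabel_two (hk : k < n) :
    innerAngleSum n d x y k (slopeLabel d k 2) = Real.pi - x k - y k := by
  obtain hk' | rfl : k + 1 < n ∨ n = k + 1 := by omega
  · have hinner : innerAngleSum n d x y (k + 1) (slopeLabel d k 2) = 0 :=
      Finset.sum_eq_zero fun i hi => Finset.sum_eq_zero fun e _ =>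
        if_neg (slopeLabel_ne_slopeLabel_two d (Finset.mem_Ico.1 hi).1 _)
    rw [innerAngleSum_slopeLabel hk', hinner, add_zero]
    rfl
  · exact innerAngleSum_slopeLabel_last x y d k 2

theorem innerAngleSum_zero_new (hk : k + 1 < n) :
    innerAngleSum n d x y 0 (k + 3) = innerAngleSum n d x y k (slopeLabel d k 3) := by
  have houter : ∑ i ∈ Finset.Ico 0 k, labelAngle n d x y i (k + 3) = 0 := by
    refine Finset.sum_eq_zero fun i hi => Finset.sum_eq_zero fun e _ => if_neg ?_
    have hik := (Finset.mem_Ico.1 hi).2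
    have hle := slopeLabel_le d i e.kind
    rw [label_of_lt (by omega)]
    omega
  rw [slopeLabel_three, innerAngleSum, innerAngleSum,
    ← Finset.sum_Ico_consecutive _ k.zero_le (by omega : k ≤ n), houter, zero_add]

theorem exists_eq_kindAngle {α : Fin n → TetEdge → ℝ}
    (hα : (triangulation n d).IsAngleStructure α) :
    ∃ x y : ℕ → ℝ, α = fun (t : Fin n) e => kindAngle (x t) (y t) e.kind := by
  let g (c : Fin 4) (k : ℕ) : ℝ := if h : k < n then α ⟨k, h⟩ (ofKind c) else 0
  have hg (t : Fin n) (c : Fin 4) : g c t = α t (ofKind c) := dif_pos t.isLt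
  have hkind (t : Fin n) (e : TetEdge) : α t e = ![g 0 t, g 1 t, g 2 t, g 2 t] e.kind := by
    have hrep : α t e = α t (ofKind (![0, 1, 2, 2] e.kind)) := by
      obtain h | h := eq_ofKind_or_opp e
      · exact congrArg _ h
      · exact (congrArg _ h).trans (hα.opp t _)
    rw [hrep, ← hg]
    generalize e.kind = c
    fin_cases c <;> rfl
  have hvertex (t : Fin n) : g 0 t + g 1 t + g 2 t = Real.pi := by
    rw [← hα.vertex t 0]
    simp only [hkind]
    exact (sum_kind_of_mem (g := ![g 0 t, g 1 t, g 2 t, g 2 t]) rfl 0).symm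
  refine ⟨g 0, g 1, funext₂ fun t e => ?_⟩
  have hdiag : Real.pi - g 0 t - g 1 t = g 2 t := by rw [← hvertex t]; ring
  rw [hkind, kindAngle, hdiag]

theorem isAngleStructure_kindAngle_iff :
    (triangulation n d).IsAngleStructure (fun t e => kindAngle (x t) (y t) e.kind) ↔
      (∀ k < n, 0 < x k ∧ 0 < y k ∧ x k + y k < Real.pi) ∧
        ∀ k, k + 1 < n → innerAngleSum n d x y 0 (k + 3) = 2 * Real.pi := by
  constructor
  · refine fun h => ⟨fun k hk => ⟨h.pos ⟨k, hk⟩ (ofKind 0), h.pos ⟨k, hk⟩ (ofKind 1), ?_⟩,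
      fun k hk => ?_⟩
    · have hz : 0 < Real.pi - x k - y k := h.pos ⟨k, hk⟩ (ofKind 2)
      linarith
    · have hlabel : label n d k (ofKind 3).kind = k + 3 := by
        rw [kind_ofKind, label_of_lt hk, slopeLabel_three]
      rw [← hlabel, ← h.interior ((triangulation n d).edge ⟨k, Nat.lt_of_succ_lt hk⟩ (ofKind 3)) ?_,
        angleSum_eq_innerAngleSum]
      rw [isBoundaryEdge_iff, hlabel]
      omega
  · rintro ⟨hpos, hinterior⟩
    refine ⟨fun t e => ?_, fun t e => ?_, fun t e => ?_, fun t v => ?_, ?_⟩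
    · simp only [kind_opp]
      generalize e.kind = c
      fin_cases c <;> rfl
    · obtain ⟨hx, hy, hxy⟩ := hpos t t.isLt
      have hz : 0 < Real.pi - x t - y t := by linarith
      generalize e.kind = c
      fin_cases c <;> assumption
    · obtain ⟨hx, hy, hxy⟩ := hpos t t.isLt
      have hx' : x t < Real.pi := by linarith
      have hy' : y t < Real.pi := by linarith
      have hz : Real.pi - x t - y t < Real.pi := by linarith
      generalize e.kind = c
      fin_cases c <;> assumption
    · rw [sum_kind_of_mem rfl]
      simp only [kindAngle, Matrix.cons_val]
      ring
    · rintro ⟨t, e⟩ hE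
      replace hE := isBoundaryEdge_iff.not.1 hE
      have hlt := label_lt (d := d) t.isLt e.kind
      refine (angleSum_eq_innerAngleSum t e).trans ?_
      rw [← hinterior (label n d t e.kind - 3) (by omega), Nat.sub_add_cancel (not_lt.1 hE)]

/-- The angles `x`, `y` of the tetrahedra from the `k`-th on are those of an angle structure with
the exterior angles `a, b, c` at the slopes of `u, w, u - w` of the `k`-th torus. -/
structure IsAngleStructureFrom (n : ℕ) (d : ℕ → Bool) (x y : ℕ → ℝ) (k : ℕ) (a b c : ℝ) : Prop where
  pos : ∀ i, k ≤ i → i < n → 0 < x i ∧ 0 < y i ∧ x i + y i < Real.pi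
  zero : innerAngleSum n d x y k (slopeLabel d k 0) = Real.pi - a
  one : innerAngleSum n d x y k (slopeLabel d k 1) = Real.pi - b
  two : innerAngleSum n d x y k (slopeLabel d k 2) = Real.pi - c
  interior : ∀ i, k ≤ i → i + 1 < n → innerAngleSum n d x y i (slopeLabel d i 3) = 2 * Real.pi

theorem isAngleStructureFrom_last_iff (hsum : a + b + c = Real.pi) :
    IsAngleStructureFrom (k + 1) d x y k a b c ↔ 0 < x k ∧ 0 < y k ∧ x k + y k = c ∧
      c < Real.pi ∧ (if d k then a + 2 * x k else b + 2 * y k) = Real.pi := by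
  have hzero := innerAngleSum_slopeLabel_last x y d k 0
  have hone := innerAngleSum_slopeLabel_last x y d k 1
  have htwo := innerAngleSum_slopeLabel_last x y d k 2
  simp only [Matrix.cons_val] at hzero hone htwo
  constructor
  · rintro ⟨hpos, ha, -, hc, -⟩
    obtain ⟨hx, hy, hxy⟩ := hpos k le_rfl k.lt_succ_self
    refine ⟨hx, hy, by linarith, by linarith, ?_⟩
    split_ifs at hzero hone ⊢ <;> linarith
  · rintro ⟨hx, hy, hxy, hc, hlast⟩
    refine ⟨fun i hki hi => ?_, ?_, ?_, by linarith, fun i hki hi => by omega⟩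
    · obtain rfl : i = k := by omega
      exact ⟨hx, hy, hxy ▸ hc⟩
    all_goals split_ifs at hzero hone hlast <;> linarith

theorem innerAngleSum_slopeLabel_succ (x y : ℕ → ℝ) (d : ℕ → Bool) (hk : k + 1 < n) :
    innerAngleSum n d x y k (slopeLabel d k 0) =
        2 * x k + innerAngleSum n d x y (k + 1) (slopeLabel d (k + 1) (if d k then 2 else 0)) ∧
      innerAngleSum n d x y k (slopeLabel d k 1) =
        2 * y k + innerAngleSum n d x y (k + 1) (slopeLabel d (k + 1) (if d k then 1 else 2)) ∧
      innerAngleSum n d x y k (slopeLabel d k 3) = Real.pi - x k - y k +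
        innerAngleSum n d x y (k + 1) (slopeLabel d (k + 1) (if d k then 0 else 1)) := by
  simp only [innerAngleSum_slopeLabel hk, Matrix.cons_val]
  cases hd : d k <;> simp [slopeLabel, prevKind, hd]

theorem isAngleStructureFrom_iff_succ (hk : k + 1 < n) :
    IsAngleStructureFrom n d x y k a b c ↔ 0 < x k ∧ 0 < y k ∧ x k + y k = c ∧ c < Real.pi ∧
      IsAngleStructureFrom n d x y (k + 1) (if d k then -c else a + 2 * x k)
        (if d k then b + 2 * y k else -c) (if d k then a + 2 * x k else b + 2 * y k) := by
  obtain ⟨hzero, hone, hthree⟩ := innerAngleSum_slopeLabel_succ x y d hk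
  have htwo := innerAngleSum_slopeLabel_two (d := d) (x := x) (y := y) (Nat.lt_of_succ_lt hk)
  constructor
  · rintro ⟨hpos, ha, hb, hc, hint⟩
    obtain ⟨hx, hy, hxy⟩ := hpos k le_rfl (Nat.lt_of_succ_lt hk)
    have hnew := hint k le_rfl hk
    refine ⟨hx, hy, by linarith, by linarith, fun i hi => hpos i (by omega), ?_, ?_, ?_,
      fun i hi => hint i (by omega)⟩
    all_goals split_ifs at hzero hone hthree ⊢ <;> linarith
  · rintro ⟨hx, hy, hxy, hc, hpos, ha, hb, hd, hint⟩
    refine ⟨fun i hki hi => ?_, ?_, ?_, by linarith, fun i hki hi => ?_⟩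
    · obtain rfl | hki := hki.eq_or_lt
      · exact ⟨hx, hy, hxy ▸ hc⟩
      · exact hpos i hki hi
    · split_ifs at hzero ha hb hd <;> linarith
    · split_ifs at hone ha hb hd <;> linarith
    · obtain rfl | hki := hki.eq_or_lt
      · split_ifs at hthree ha hb hd <;> linarith
      · exact hint i hki hi

theorem isAngleStructureFrom_iff_isPleating {j : ℕ} (hj : k + j + 1 = n)
    (hsum : a + b + c = Real.pi) :
    IsAngleStructureFrom n d x y k a b c ↔
      IsPleating (j + 1) (fun i => d (k + i)) (fun i => x (k + i)) (fun i => y (k + i)) a b c := by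
  induction j generalizing k a b c with
  | zero =>
    subst hj
    rw [isAngleStructureFrom_last_iff hsum]
    rfl
  | succ j ih =>
    rw [isAngleStructureFrom_iff_succ (by omega), IsPleating]
    refine and_congr_right fun _ => and_congr_right fun _ => and_congr_right fun hxy =>
      and_congr_right fun _ => ?_
    rw [ih (by omega) (by split_ifs <;> linarith)]
    simp only [Nat.add_right_comm k 1, Nat.add_assoc, add_zero]

theorem angleSum_ofKind_eq (hn : 0 < n) {c : Fin 4} (hc : c ≠ 3) :
    (triangulation n d).angleSum (fun t e => kindAngle (x t) (y t) e.kind)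
      ((triangulation n d).edge ⟨0, hn⟩ (ofKind c)) =
        innerAngleSum n d x y 0 (slopeLabel d 0 c) := by
  rw [angleSum_eq_innerAngleSum, kind_ofKind, label_of_ne hc]

theorem isAngleStructureFrom_zero_iff :
    IsAngleStructureFrom n d x y 0 a b c ↔
      (triangulation n d).IsAngleStructure (fun t e => kindAngle (x t) (y t) e.kind) ∧
        innerAngleSum n d x y 0 (slopeLabel d 0 0) = Real.pi - a ∧
        innerAngleSum n d x y 0 (slopeLabel d 0 1) = Real.pi - b ∧
        innerAngleSum n d x y 0 (slopeLabel d 0 2) = Real.pi - c := by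
  rw [isAngleStructure_kindAngle_iff]
  constructor
  · rintro ⟨hpos, ha, hb, hc, hint⟩
    exact ⟨⟨fun k => hpos k k.zero_le, fun k hk =>
      (innerAngleSum_zero_new hk).trans (hint k k.zero_le hk)⟩, ha, hb, hc⟩
  · rintro ⟨⟨hpos, hint⟩, ha, hb, hc⟩
    exact ⟨fun k _ => hpos k, ha, hb, hc, fun k _ hk =>
      (innerAngleSum_zero_new hk).symm.trans (hint k hk)⟩

theorem exists_isAngleStructure_iff (hn : 0 < n) (hsum : a + b + c = Real.pi) (ha : a < Real.pi)
    (hb : b < Real.pi) (hc : 0 < c) (hc' : c < Real.pi) :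
    (∃ α, (triangulation n d).IsAngleStructure α ∧
      (triangulation n d).angleSum α ((triangulation n d).edge ⟨0, hn⟩ (ofKind 0)) = Real.pi - a ∧
      (triangulation n d).angleSum α ((triangulation n d).edge ⟨0, hn⟩ (ofKind 1)) = Real.pi - b ∧
      (triangulation n d).angleSum α ((triangulation n d).edge ⟨0, hn⟩ (ofKind 2)) =
        Real.pi - c) ↔ 2 * Real.pi < meridianSum n d a b c := by
  obtain ⟨n, rfl⟩ := Nat.exists_eq_add_one.2 hn
  have hpleating (x y : ℕ → ℝ) : IsPleating (n + 1) d x y a b c ↔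
      IsAngleStructureFrom (n + 1) d x y 0 a b c := by
    rw [isAngleStructureFrom_iff_isPleating (by rw [zero_add]) hsum]
    simp only [zero_add]
  rw [← exists_isPleating_iff hsum ha hb hc hc']
  simp only [hpleating, isAngleStructureFrom_zero_iff]
  constructor
  · rintro ⟨α, hα, h⟩
    obtain ⟨x, y, rfl⟩ := exists_eq_kindAngle hα
    refine ⟨x, y, hα, ?_⟩
    rwa [angleSum_ofKind_eq hn (by decide), angleSum_ofKind_eq hn (by decide),
      angleSum_ofKind_eq hn (by decide)] at h
  · rintro ⟨x, y, hα, h⟩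
    refine ⟨_, hα, ?_⟩
    rwa [angleSum_ofKind_eq hn (by decide), angleSum_ofKind_eq hn (by decide),
      angleSum_ofKind_eq hn (by decide)]

end LayeredSolidTorus

/-! ### Boundary slopes -/

namespace LayeredSolidTorus

open TetEdge

/-- The slope of the edges of a given kind in a tetrahedron with the sides `b = (u, w)`. -/
def kindSlope (b : (ℤ × ℤ) × (ℤ × ℤ)) : Fin 4 → Slope :=
  ![ofVec b.1, ofVec b.2, ofVec (b.1 - b.2), ofVec (b.1 + b.2)]

theorem kindSlope_inj {b : (ℤ × ℤ) × (ℤ × ℤ)} (h : IsLatticeBasis b.1 b.2) {c c' : Fin 4}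
    (hc : c ≠ 3) (hc' : c' ≠ 3) (heq : kindSlope b c = kindSlope b c') : c = c' := by
  have h₀₁ := h.ofVec_ne
  have h₀₂ := h.sub_right.ofVec_ne
  have h₁₂ : ofVec b.2 ≠ ofVec (b.1 - b.2) := by
    rw [← ofVec_neg (b.1 - b.2), neg_sub]
    exact h.symm.sub_right.ofVec_ne
  unfold kindSlope at heq
  fin_cases c <;> fin_cases c' <;> first
    | rfl
    | exact absurd rfl hc
    | exact absurd rfl hc'
    | exact absurd heq ‹_›
    | exact absurd heq.symm ‹_›

variable {p q r m : Slope} {γ : FareyPath {p, q, r} m} {k : ℕ}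

theorem ofVec_pos_sub {e : TetEdge} {i j : Fin 4} (hij : i ≠ j) (he : e.1 = {i, j}) :
    ofVec (pos p q r γ k j - pos p q r γ k i) = kindSlope (frame p q r γ k) e.kind := by
  have kind_eq : ∀ (i j : Fin 4) (e : TetEdge), i ≠ j → e.1 = {i, j} →
      e.kind = (![![0, 0, 3, 1], ![0, 0, 1, 2], ![3, 1, 0, 0], ![1, 2, 0, 0]] :
        Fin 4 → Fin 4 → Fin 4) i j := by decide
  have ofVec_eq : ∀ v v' : ℤ × ℤ, v = v' ∨ v = -v' → ofVec v = ofVec v' := by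
    rintro v v' (rfl | rfl)
    exacts [rfl, ofVec_neg v']
  rw [kind_eq i j e hij he]
  unfold pos kindSlope
  generalize frame p q r γ k = b
  fin_cases i <;> fin_cases j <;> first
    | exact absurd rfl hij
    | (refine ofVec_eq _ _ (Or.inl ?_); simp; done)
    | (refine ofVec_eq _ _ (Or.inr ?_); simp)

theorem hasSlope_iff {e : TetEdge} {s : Slope} :
    HasSlope p q r γ k e s ↔ kindSlope (frame p q r γ k) e.kind = s := by
  constructor
  · rintro ⟨i, j, hij, he, hs⟩
    exact (ofVec_pos_sub hij he).symm.trans hs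
  · intro hs
    obtain ⟨i, j, hij, he⟩ := Finset.card_eq_two.1 e.2
    exact ⟨i, j, hij, he, (ofVec_pos_sub hij he).trans hs⟩

theorem hasBoundaryAngle_iff (hpqr : IsFareyTriangle {p, q, r}) (hn : 0 < γ.length - 1)
    {α : Fin (γ.length - 1) → TetEdge → ℝ} {c : Fin 4} (hc : c ≠ 3) {s : Slope}
    (hs : kindSlope (frame p q r γ 0) c = s) {a : ℝ} :
    HasBoundaryAngle p q r γ α s a ↔
      (layeredSolidTorus p q r γ).angleSum α
        ((layeredSolidTorus p q r γ).edge ⟨0, hn⟩ (ofKind c)) = a := by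
  constructor
  · intro h
    obtain ⟨f, hf2, hf⟩ := exists_outer_face hc
    exact h _ _ f hf (glue_eq_none_iff.2 ⟨rfl, hf2⟩) (hasSlope_iff.2 (by rwa [kind_ofKind]))
  · rintro h ⟨t, ht⟩ e f hf hglue hslope
    obtain ⟨rfl : t = 0, hf2⟩ := glue_eq_none_iff.1 hglue
    have hkind : (ofKind c).kind = e.kind := (kind_ofKind c).trans
      (kindSlope_inj (isLatticeBasis_frame_zero hpqr γ) (kind_ne_three_of_outer hf2 hf) hc
        ((hasSlope_iff.1 hslope).trans hs.symm)).symm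
    rw [← h]
    exact congrArg _ (edge_eq_of_kind_eq _ ht hkind.symm)

end LayeredSolidTorus

open LayeredSolidTorus in
theorem mainTheorem6 (p q r m : Slope) (hpqr : IsFareyTriangle {p, q, r})
    (γ : FareyPath {p, q, r} m) (hN : 2 ≤ γ.length)
    (hr : r ∉ γ.tri 1) (hp : p ∉ γ.tri 2)
    (θp θq θr : ℝ) (hsum : θp + θq + θr = Real.pi)
    (hθp : -Real.pi < θp ∧ θp < Real.pi) (hθq : -Real.pi < θq ∧ θq < Real.pi)
    (hθr : 0 < θr ∧ θr < Real.pi) :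
    (∃ α : Fin (γ.length - 1) → TetEdge → ℝ,
      (layeredSolidTorus p q r γ).IsAngleStructure α ∧
      HasBoundaryAngle p q r γ α p (Real.pi - θp) ∧
      HasBoundaryAngle p q r γ α q (Real.pi - θq) ∧
      HasBoundaryAngle p q r γ α r (Real.pi - θr)) ↔
    2 * Real.pi < Slope.inter m p * θp + Slope.inter m q * θq + Slope.inter m r * θr := by
  have hn : 0 < γ.length - 1 := by omega
  obtain ⟨hmp, hmq, hmr⟩ := inter_meridian hpqr γ (by omega) hr
  have hmeridian : (inter m p * θp + inter m q * θq + inter m r * θr : ℝ) =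
      meridianSum (γ.length - 1) (dropsU p q r γ) θp θq θr := by
    rw [hmp, hmq, hmr, Nat.cast_add, meridianSum]
  rw [hmeridian, ← exists_isAngleStructure_iff hn hsum hθp.2 hθq.2 hθr.1 hθr.2]
  obtain ⟨hslope_p, hslope_q, hslope_r⟩ := ofVec_frame_zero hpqr γ
  refine exists_congr fun α => and_congr_right fun _ => and_congr ?_ (and_congr ?_ ?_)
  · exact hasBoundaryAngle_iff hpqr hn (c := 0) (by decide) hslope_p
  · exact hasBoundaryAngle_iff hpqr hn (c := 1) (by decide) hslope_q
  · exact hasBoundaryAngle_iff hpqr hn (c := 2) (by decide) hslope_r
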